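/- **Noise sensitivity.** Let $f_n:\{-1,1\}^{N_n}\to\{-1,1\}$ be a sequence of Boolean functions. Let $\omega$ be uniform on $\{-1,1\}^{N_n}$, and let $\omega^\epsilon$ be obtained from $\omega$ by flipping each bit independently with probability $\epsilon$. The sequence $\{f_n\}$ is *noise sensitive* if $\lim_{n\to\infty}\mathrm{Cov}(f_n(\omega),f_n(\omega^\epsilon))=0$ for every $0<\epsilon\le 1/2$. **Induced function.** A layered graph with an input layer $0$, a single top node, and edges only between consecutive layers induces a Boolean function as follows: the nodes of layer $0$ carry the input bits, every node in a higher layer takes the majority (sign of the sum) of the values of the nodes of the layer below to which it is joined, and the output is the value of the top node. **Graphs.** - $G^{(2)}_n$ has layers $k=0,\dots,n$. Layer $k$ has the nodes $v_{k,1},\dots,v_{k,2^{n-k+1}-1}$, and $v_{k+1,i}$ is joined to $v_{k,j}$ if and only if $|j-2i|\le 1$. - For odd $m\ge 3$ and $T\ge 0$, the cyclic variant $G^{(2')}_{m,T}$ has layers $k=0,\dots,T+1$. For $k\le T$ layer $k$ is a cycle of $m2^{T-k}$ nodes $v_{k,1},\dots,v_{k,m2^{T-k}}$, and for $k<T$ the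 node $v_{k+1,i}$ is joined to $v_{k,j}$ if and only if $j\equiv 2i-1$, $2i$ or $2i+1 \pmod{m2^{T-k}}$. Layer $T+1$ is the single output node, joined to all $m$ nodes of layer $T$. **Theorem.** The sequence of convolutional iterated 3-majority functions with stride 2 induced by $G^{(2)}_n$, $n\ge 0$, is noise sensitive. Moreover, for all sequences of odd integers $m_n\ge 3$ and of integers $T_n\ge 0$ with $T_n\to\infty$, the sequence of functions induced by the cyclic graphs $G^{(2')}_{m_n,T_n}$ is noise sensitive. -/

import Mathlib

open MeasureTheory ProbabilityTheory Filter Topology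

/-- Every subset of `{-1, 1}` is measurable. -/
instance instMeasurableSingletonClassIntUnits : MeasurableSingletonClass ℤˣ where
  measurableSet_singleton u :=
    ⟨{(u : ℤ)}, MeasurableSet.singleton _, by ext v; simp [Units.ext_iff]⟩

/-- The uniform law on `{-1, 1}`. -/
noncomputable def uniformBit : Measure ℤˣ :=
  ENNReal.ofReal (1 / 2) • Measure.dirac 1 + ENNReal.ofReal (1 / 2) • Measure.dirac (-1)

/-- The law of a single noise bit: `-1` (flip) with probability `ε`, `1` (keep) with
probability `1 - ε`. -/
noncomputable def noiseBit (ε : ℝ) : Measure ℤˣ :=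
  ENNReal.ofReal (1 - ε) • Measure.dirac 1 + ENNReal.ofReal ε • Measure.dirac (-1)

/-- The joint law of a uniform input `ω` and an independent i.i.d. vector `s` of noise bits.
The perturbed input is the coordinatewise product `ω * s`. -/
noncomputable def noiseLaw (ι : Type) [Fintype ι] (ε : ℝ) :
    Measure ((ι → ℤˣ) × (ι → ℤˣ)) :=
  (Measure.pi fun _ : ι => uniformBit).prod (Measure.pi fun _ : ι => noiseBit ε)

/-- `Cov(f(ω), f(ω^ε))`. -/
noncomputable def noiseCov {ι : Type} [Fintype ι] (f : (ι → ℤˣ) → ℤˣ) (ε : ℝ) : ℝ :=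
  covariance (fun p : (ι → ℤˣ) × (ι → ℤˣ) => (((f p.1 : ℤˣ) : ℤ) : ℝ))
    (fun p : (ι → ℤˣ) × (ι → ℤˣ) => (((f (p.1 * p.2) : ℤˣ) : ℤ) : ℝ)) (noiseLaw ι ε)

/-- Noise sensitivity of a sequence of Boolean functions `f n : {-1, 1}^(ι n) → {-1, 1}`. -/
def NoiseSensitive {ι : ℕ → Type} [∀ n, Fintype (ι n)]
    (f : ∀ n, (ι n → ℤˣ) → ℤˣ) : Prop :=
  ∀ ε : ℝ, 0 < ε → ε ≤ 1 / 2 → Tendsto (fun n => noiseCov (f n) ε) atTop (𝓝 0)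

/-- A finite layered graph. Layer `k` (for `k = 0, …, height`) has the nodes
`v_{k,1}, …, v_{k, width k}`, layer `0` is the input layer and the top layer is a single node.
`edge k i j` says that `v_{k+1,i}` is joined to `v_{k,j}`.  Edges join consecutive layers only.
Values of `width` and `edge` above the height play no role. -/
structure LayeredGraph where
  height : ℕ
  width : ℕ → ℕ
  width_height : width height = 1
  edge : ℕ → ℕ → ℕ → Prop

namespace LayeredGraph

/-- The nodes of layer `k`. -/
abbrev Node (G : LayeredGraph) (k : ℕ) : Type := ↥(Finset.Icc 1 (G.width k))

open Classical in
/-- The children in layer `k` of a node in layer `k + 1`. -/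
noncomputable def children (G : LayeredGraph) (k : ℕ) (v : G.Node (k + 1)) :
    Finset (G.Node k) :=
  Finset.univ.filter fun u => G.edge k v u

/-- The value of every node: input bits on layer `0`, and the sign of the sum of the values of the
children (their majority, when their number is odd) on the higher layers. -/
noncomputable def value (G : LayeredGraph) (ω : G.Node 0 → ℤˣ) : (k : ℕ) → G.Node k → ℤˣ
  | 0, v => ω v
  | k + 1, v => if 0 < ∑ u ∈ G.children k v, ((G.value ω k u : ℤˣ) : ℤ) then 1 else -1

/-- The single node of the top layer. -/
def root (G : LayeredGraph) : G.Node G.height :=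
  ⟨1, by simp [G.width_height]⟩

/-- The Boolean function induced by the graph. -/
noncomputable def output (G : LayeredGraph) (ω : G.Node 0 → ℤˣ) : ℤˣ :=
  G.value ω G.height G.root

end LayeredGraph

/-- The graph of the convolutional iterated 3-majority function with stride 2 and `n` levels of
majorities: layer `k` has `2 ^ (n - k + 1) - 1` nodes, and `v_{k+1,i}` is joined to `v_{k,j}` iff
`|j - 2 i| ≤ 1`. -/
def strideTwoGraph (n : ℕ) : LayeredGraph where
  height := n
  width k := 2 ^ (n - k + 1) - 1
  width_height := by simp
  edge _ i j := |(j : ℤ) - 2 * i| ≤ 1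

/-- The cyclic variant. For `k ≤ T` layer `k` is a cycle of `m * 2 ^ (T - k)` nodes; for `k < T` the
node `v_{k+1,i}` is joined to `v_{k,j}` iff `j` is congruent to one of `2i-1, 2i, 2i+1` modulo the
length of the cycle in layer `k`.  The output node, in layer `T + 1`, is joined to all the `m` nodes
of layer `T`. -/
def strideTwoCycle (m T : ℕ) : LayeredGraph where
  height := T + 1
  width k := if k ≤ T then m * 2 ^ (T - k) else 1
  width_height := by simp
  edge k i j :=
    if k < T then ∃ e : ℤ, |e| ≤ 1 ∧ (j : ℤ) ≡ 2 * i + e [ZMOD ((m * 2 ^ (T - k) : ℕ) : ℤ)]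
    else True

/-!
If some randomized algorithm computes a Boolean function while reading each input bit with
probability at most `δ`, then the Walsh weight of the function at each level `d ≥ 1` is at most
`d * δ` (Schramm and Steif), so a sequence of functions with revealments tending to `0` is noise
sensitive. The Schramm–Steif bound is Cauchy–Schwarz for `f` against its degree-`d` part, in which
each character is kept only where the algorithm reads a bit of its support: the characters thus
truncated are still orthogonal, because the algorithm cannot tell whether a bit that it does not
read has been reversed.

An iterated 3-majority with stride two is computed from the top down, each layer having a random
coin in `ZMod 4`: at every node, a child whose residue is the coin is looked at last, and is skipped
when its two siblings agree. Fix an input bit. If 19 suitable nodes of layer `k` near the bit take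
the value `1`, which by the Harris inequality has probability at least `(1 / 2) ^ 19`, and if the
coins of the two layers `k + 1` and `k + 2` take suitable values, then the evaluation of layer
`k + 3` does not read the bit. These events depend on other inputs and other coins than whether the
evaluation of layer `k` reads the bit, so every three layers multiply the revealment by at most
`1 - (1 / 2) ^ 23`.

Both kinds of graphs are treated by unfolding them to the integers, the bits of a cycle being
repeated periodically.
-/

open scoped BigOperators

section FiniteProbability

variable {Ω Ω' : Type*} [Fintype Ω] [Fintype Ω']

/-- The probability of the event `A` under the uniform law on the finite type `Ω`. -/
noncomputable def prob (A : Set Ω) : ℝ := 𝔼 ω, A.indicator 1 ω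

lemma indicator_one_nonneg {α : Type*} (A : Set α) (ω : α) : (0 : ℝ) ≤ A.indicator 1 ω :=
  Set.indicator_nonneg (fun _ _ => zero_le_one) ω

lemma prob_nonneg (A : Set Ω) : 0 ≤ prob A :=
  Finset.expect_nonneg fun ω _ => indicator_one_nonneg A ω

lemma prob_mono {A B : Set Ω} (h : A ⊆ B) : prob A ≤ prob B :=
  Finset.expect_le_expect fun ω _ =>
    Set.indicator_le_indicator_of_subset h (fun _ => zero_le_one) ω

lemma prob_le_one (A : Set Ω) : prob A ≤ 1 := by
  cases isEmpty_or_nonempty Ω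
  · simp [prob]
  · exact Finset.expect_le Finset.univ_nonempty fun ω _ =>
      Set.indicator_le_self' (fun _ _ => zero_le_one) ω

lemma prob_diff (A B : Set Ω) : prob (A \ B) = prob A - prob (A ∩ B) := by
  rw [prob, prob, prob, ← Finset.expect_sub_distrib]
  exact Finset.expect_congr rfl fun ω _ => by
    by_cases hA : ω ∈ A <;> by_cases hB : ω ∈ B <;> simp [hA, hB]

lemma prob_biUnion_le {α : Type*} (s : Finset α) (A : α → Set Ω) :
    prob (⋃ i ∈ s, A i) ≤ ∑ i ∈ s, prob (A i) := by
  simp only [prob]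
  rw [← Finset.expect_sum_comm]
  refine Finset.expect_le_expect fun ω _ => ?_
  by_cases h : ω ∈ ⋃ i ∈ s, A i
  · obtain ⟨i, hi, hω⟩ := Set.mem_iUnion₂.1 h
    rw [Set.indicator_of_mem h]
    simpa [hω] using Finset.single_le_sum (fun i _ => indicator_one_nonneg (A i) ω) hi
  · rw [Set.indicator_of_notMem h]
    exact Finset.sum_nonneg fun i _ => indicator_one_nonneg (A i) ω

lemma prob_eq_expect_section (A : Set (Ω × Ω')) : prob A = 𝔼 a, prob {b | (a, b) ∈ A} := by
  simp only [prob]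
  rw [← Finset.univ_product_univ, Finset.expect_product]
  rfl

lemma prob_prod (A : Set Ω) (B : Set Ω') : prob (A ×ˢ B) = prob A * prob B := by
  rw [prob_eq_expect_section, prob, Finset.expect_mul]
  exact Finset.expect_congr rfl fun a _ => by by_cases h : a ∈ A <;> simp [h, prob]

lemma prob_preimage_equiv (e : Ω ≃ Ω') (A : Set Ω') : prob (e ⁻¹' A) = prob A :=
  Fintype.expect_equiv e _ _ fun _ => rfl

lemma prob_univ [Nonempty Ω] : prob (Set.univ : Set Ω) = 1 := by simp [prob]

lemma one_half_le_prob [Nonempty Ω] (e : Ω ≃ Ω) {A : Set Ω} (h : ∀ ω, ω ∈ A ∨ e ω ∈ A) :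
    1 / 2 ≤ prob A := by
  have key : (1 : ℝ) ≤ prob A + prob (e ⁻¹' A) := by
    rw [prob, prob, ← Finset.expect_add_distrib]
    refine Finset.le_expect Finset.univ_nonempty fun ω _ => ?_
    have h₁ := indicator_one_nonneg A ω
    have h₂ := indicator_one_nonneg (e ⁻¹' A) ω
    rcases h ω with hω | hω
    · rw [Set.indicator_of_mem hω, Pi.one_apply]; linarith
    · rw [Set.indicator_of_mem (show ω ∈ e ⁻¹' A from hω), Pi.one_apply]; linarith
  rw [prob_preimage_equiv] at key
  linarith

lemma monotone_indicator_one {α : Type*} [Preorder α] {A : Set α} (hA : IsUpperSet A) :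
    Monotone (A.indicator (1 : α → ℝ)) := fun a b hab => by
  by_cases ha : a ∈ A
  · simp [ha, hA hab ha]
  · rw [Set.indicator_of_notMem ha]
    exact indicator_one_nonneg A b

lemma prob_mul_prob_le_prob_inter [DistribLattice Ω] {A B : Set Ω} (hA : IsUpperSet A)
    (hB : IsUpperSet B) : prob A * prob B ≤ prob (A ∩ B) := by
  have harris := fkg (μ := fun _ : Ω => (1 : ℝ)) _ _ zero_le_one (indicator_one_nonneg A)
    (indicator_one_nonneg B) (monotone_indicator_one hA)
    (monotone_indicator_one hB) fun _ _ => le_rfl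
  simp only [one_mul, Finset.sum_const, nsmul_eq_mul, mul_one, Finset.card_univ] at harris
  cases isEmpty_or_nonempty Ω
  · simp [prob]
  simp only [prob, Fintype.expect_eq_sum_div_card, Set.inter_indicator_one, Pi.mul_apply]
  rw [div_mul_div_comm, div_le_div_iff₀ (by positivity) (by positivity)]
  linarith [mul_le_mul_of_nonneg_right harris (Nat.cast_nonneg (α := ℝ) (Fintype.card Ω))]

lemma pow_card_le_prob_biInter [DistribLattice Ω] [Nonempty Ω] {α : Type*} {A : α → Set Ω}
    (hA : ∀ i, IsUpperSet (A i)) {r : ℝ} (hr : 0 ≤ r) (s : Finset α)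
    (h : ∀ i ∈ s, r ≤ prob (A i)) : r ^ s.card ≤ prob (⋂ i ∈ s, A i) := by
  classical
  induction s using Finset.induction_on with
  | empty => simp [prob]
  | insert a s ha ih =>
    rw [Finset.forall_mem_insert] at h
    rw [Finset.card_insert_of_notMem ha, pow_succ', Finset.set_biInter_insert]
    exact (mul_le_mul h.1 (ih h.2) (by positivity) (prob_nonneg _)).trans
      (prob_mul_prob_le_prob_inter (hA a) (isUpperSet_iInter₂ fun i _ => hA i))

variable {I J V W : Type*} [Fintype I] [DecidableEq I] [Fintype J] [DecidableEq J]
  [Fintype V] [Fintype W]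

lemma prob_inter_of_dependsOn {A B : Set ((I → V) × (J → W))} {C : Set I} {D : Set J}
    (hA : ∀ a b, Set.EqOn a.1 b.1 C → Set.EqOn a.2 b.2 D → (a ∈ A ↔ b ∈ A))
    (hB : ∀ a b, Set.EqOn a.1 b.1 Cᶜ → Set.EqOn a.2 b.2 Dᶜ → (a ∈ B ↔ b ∈ B)) :
    prob (A ∩ B) = prob A * prob B := by
  classical
  let mix (a b : (I → V) × (J → W)) : (I → V) × (J → W) :=
    (C.piecewise a.1 b.1, D.piecewise a.2 b.2)
  have mix_mix (a b) : mix (mix a b) (mix b a) = a := by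
    ext i
    · by_cases h : i ∈ C <;> simp [mix, h]
    · by_cases h : i ∈ D <;> simp [mix, h]
  have mem_A (a b) : mix a b ∈ A ↔ a ∈ A :=
    hA _ _ (Set.piecewise_eqOn _ _ _) (Set.piecewise_eqOn _ _ _)
  have mem_B (a b) : mix a b ∈ B ↔ b ∈ B :=
    hB _ _ (Set.piecewise_eqOn_compl _ _ _) (Set.piecewise_eqOn_compl _ _ _)
  have swap : Function.Involutive fun x : ((I → V) × (J → W)) × ((I → V) × (J → W)) =>
      (mix x.1 x.2, mix x.2 x.1) := fun x => Prod.ext (mix_mix _ _) (mix_mix _ _)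
  have preimage_swap : swap.toPerm ⁻¹' ((A ∩ B) ×ˢ Set.univ) = A ×ˢ B := by
    ext x
    simp [mem_A, mem_B]
  cases isEmpty_or_nonempty ((I → V) × (J → W))
  · simp [prob]
  rw [← prob_prod, ← preimage_swap, prob_preimage_equiv, prob_prod, prob_univ, mul_one]

lemma prob_coe (s : Finset Ω) : prob (s : Set Ω) = s.card / Fintype.card Ω := by
  classical
  simp [prob, Fintype.expect_eq_sum_div_card, Set.indicator_apply]

lemma prob_forall_mem_eq (s : Finset I) (u : I → V) :
    prob {c : I → V | ∀ i ∈ s, c i = u i} = (1 / Fintype.card V) ^ s.card := by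
  classical
  have setOf_eq : {c : I → V | ∀ i ∈ s, c i = u i} =
      ↑(Fintype.piFinset fun i => if i ∈ s then {u i} else Finset.univ) := by
    ext c
    simp only [Set.mem_ofPred_eq, Finset.mem_coe, Fintype.mem_piFinset]
    exact forall_congr' fun i => by split_ifs with h <;> simp [h]
  have card_ne_zero (i : I) : (Fintype.card V : ℝ) ≠ 0 := by
    have : Nonempty V := ⟨u i⟩
    positivity
  rw [setOf_eq, prob_coe, Fintype.card_piFinset, Fintype.card_fun, ← Finset.card_univ (α := I),
    ← Finset.prod_const, ← Finset.prod_const]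
  push_cast
  rw [← Finset.prod_div_distrib, ← Finset.prod_subset (Finset.subset_univ s)]
  · exact Finset.prod_congr rfl fun i hi => by simp [hi]
  · exact fun i _ hi => by simp [hi, card_ne_zero i]

end FiniteProbability

section Walsh

variable {ι : Type*}

/-- The Walsh character of `S`; these products of coordinates form an orthonormal basis of the real
functions on the discrete cube. -/
def walsh (S : Finset ι) (ω : ι → ℤˣ) : ℝ := ∏ i ∈ S, ((ω i : ℤ) : ℝ)

lemma cast_units_mul_self (u : ℤˣ) : ((u : ℤ) : ℝ) * ((u : ℤ) : ℝ) = 1 := by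
  rcases Int.units_eq_one_or u with rfl | rfl <;> norm_num

lemma walsh_mul_self (S : Finset ι) (ω : ι → ℤˣ) : walsh S ω * walsh S ω = 1 := by
  rw [walsh, ← Finset.prod_mul_distrib]
  exact Finset.prod_eq_one fun i _ => cast_units_mul_self _

lemma walsh_mul (S : Finset ι) (ω η : ι → ℤˣ) : walsh S (ω * η) = walsh S ω * walsh S η := by
  simp [walsh, Finset.prod_mul_distrib]

variable [DecidableEq ι]

/-- The configuration `ω` with the bit at `i` reversed. -/
def flipBit (i : ι) (ω : ι → ℤˣ) : ι → ℤˣ := Function.update ω i (-ω i)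

lemma flipBit_involutive (i : ι) : Function.Involutive (flipBit i) := fun ω => by simp [flipBit]

lemma eqOn_flipBit {A : Set ι} {i : ι} (h : i ∉ A) (ω : ι → ℤˣ) : Set.EqOn ω (flipBit i ω) A :=
  fun _ hj => (Function.update_of_ne (ne_of_mem_of_not_mem hj h) _ _).symm

lemma walsh_flipBit_of_notMem {S : Finset ι} {i : ι} (h : i ∉ S) (ω : ι → ℤˣ) :
    walsh S (flipBit i ω) = walsh S ω :=
  Finset.prod_congr rfl fun j hj => by rw [eqOn_flipBit (A := S) h ω hj]

lemma walsh_flipBit_of_mem {S : Finset ι} {i : ι} (h : i ∈ S) (ω : ι → ℤˣ) :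
    walsh S (flipBit i ω) = -walsh S ω := by
  have split (η : ι → ℤˣ) : walsh S η = ((η i : ℤ) : ℝ) * walsh (S.erase i) η :=
    (Finset.mul_prod_erase S (fun j => ((η j : ℤ) : ℝ)) h).symm
  rw [split, split ω, walsh_flipBit_of_notMem (Finset.notMem_erase i S)]
  simp [flipBit]

lemma walsh_mul_walsh (S T : Finset ι) (ω : ι → ℤˣ) :
    walsh S ω * walsh T ω = walsh (symmDiff S T) ω := by
  have walsh_eq_prod {U : Finset ι} (hU : U ⊆ S ∪ T) :
      walsh U ω = ∏ i ∈ S ∪ T, if i ∈ U then ((ω i : ℤ) : ℝ) else 1 := by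
    rw [Finset.prod_ite_mem, Finset.inter_eq_right.2 hU, walsh]
  rw [walsh_eq_prod Finset.subset_union_left, walsh_eq_prod Finset.subset_union_right,
    walsh_eq_prod symmDiff_le_sup, ← Finset.prod_mul_distrib]
  refine Finset.prod_congr rfl fun i _ => ?_
  by_cases hS : i ∈ S <;> by_cases hT : i ∈ T <;>
    simp [hS, hT, Finset.mem_symmDiff, cast_units_mul_self]

variable [Fintype ι]

lemma expect_eq_zero_of_flipBit (i : ι) (g : (ι → ℤˣ) → ℝ) (h : ∀ ω, g (flipBit i ω) = -g ω) :
    𝔼 ω, g ω = 0 := by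
  have expect_eq_neg : 𝔼 ω, g ω = 𝔼 ω, -g ω :=
    (Fintype.expect_equiv (flipBit_involutive i).toPerm _ _ fun ω => (h ω).symm).symm
  rw [Finset.expect_neg_distrib] at expect_eq_neg
  linarith

lemma walsh_eq_prod_univ (S : Finset ι) (ω : ι → ℤˣ) :
    walsh S ω = ∏ i, if i ∈ S then ((ω i : ℤ) : ℝ) else 1 := by
  simp [walsh, Finset.prod_ite_mem]

/-- The Walsh (Fourier) coefficient of `f` at `S`. -/
noncomputable def walshCoeff (f : (ι → ℤˣ) → ℝ) (S : Finset ι) : ℝ := 𝔼 ω, f ω * walsh S ω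

lemma sum_walsh_mul_walsh (ω η : ι → ℤˣ) :
    ∑ S : Finset ι, walsh S ω * walsh S η = if η = ω then (Fintype.card (ι → ℤˣ) : ℝ) else 0 := by
  have sum_eq_prod : ∑ S : Finset ι, walsh S ω * walsh S η =
      ∏ i, (1 + ((ω i : ℤ) : ℝ) * ((η i : ℤ) : ℝ)) := by
    rw [Finset.prod_one_add, Finset.powerset_univ]
    simp only [walsh, Finset.prod_mul_distrib]
  rw [sum_eq_prod]
  split_ifs with h
  · subst h
    simp only [cast_units_mul_self]
    norm_num
  · obtain ⟨i, hi⟩ := Function.ne_iff.1 h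
    refine Finset.prod_eq_zero (Finset.mem_univ i) ?_
    simp [Int.units_ne_iff_eq_neg.1 hi, cast_units_mul_self]

lemma sum_walshCoeff_mul_walsh (f : (ι → ℤˣ) → ℝ) (ω : ι → ℤˣ) :
    ∑ S : Finset ι, walshCoeff f S * walsh S ω = f ω := by
  have inversion (η : ι → ℤˣ) : ∑ S : Finset ι, f η * walsh S η * walsh S ω =
      f η * if η = ω then (Fintype.card (ι → ℤˣ) : ℝ) else 0 := by
    simp only [mul_assoc, ← Finset.mul_sum, sum_walsh_mul_walsh, eq_comm]
  simp only [walshCoeff, Fintype.expect_eq_sum_div_card, div_mul_eq_mul_div, Finset.sum_mul]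
  rw [← Finset.sum_div, Finset.sum_comm]
  simp [inversion]

/-- The Walsh weight of `f` at level `d`: the squared norm of its component of degree `d`. -/
noncomputable def walshWeight (f : (ι → ℤˣ) → ℝ) (d : ℕ) : ℝ :=
  ∑ S ∈ Finset.univ.powersetCard d, walshCoeff f S ^ 2

lemma walshWeight_nonneg (f : (ι → ℤˣ) → ℝ) (d : ℕ) : 0 ≤ walshWeight f d :=
  Finset.sum_nonneg fun _ _ => sq_nonneg _

end Walsh

section Revealment

variable {ι V α : Type*}

/-- The bits of `ω` in the random set `J ω` determine the value of `f` at `ω`. A set `J` that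
determines itself is a stopping set: it can be explored without looking outside it. -/
def Determines (J : (ι → V) → Set ι) (f : (ι → V) → α) : Prop :=
  ∀ ⦃ω η⦄, Set.EqOn ω η (J ω) → f η = f ω

lemma Determines.of_factorsThrough {J : (ι → V) → Set ι} {f : (ι → V) → α} {β : Type*}
    {g : (ι → V) → β} (hf : Determines J f) (hg : g.FactorsThrough f) : Determines J g :=
  fun _ _ h => hg (hf h)

/-- The event that the random set `J` meets `S`. -/
def hits (J : (ι → V) → Set ι) (S : Finset ι) : Set (ι → V) := {ω | ∃ i ∈ S, i ∈ J ω}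

lemma Determines.indicator_hits {J : (ι → V) → Set ι} (hJ : Determines J J) (S : Finset ι) :
    Determines J ((hits J S).indicator (1 : (ι → V) → ℝ)) := fun ω η hωη => by
  classical
  simp only [Set.indicator_apply, hits, Set.mem_ofPred_eq, hJ hωη, Pi.one_apply]

section Flip

variable [DecidableEq ι] {J : (ι → ℤˣ) → Set ι}

lemma Determines.apply_flipBit {f : (ι → ℤˣ) → α} (h : Determines J f) {i : ι} {ω : ι → ℤˣ}
    (hi : i ∉ J ω) : f (flipBit i ω) = f ω :=
  h (eqOn_flipBit hi ω)

lemma Determines.mem_apply_flipBit (hJ : Determines J J) (i : ι) (ω : ι → ℤˣ) :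
    i ∈ J (flipBit i ω) ↔ i ∈ J ω := by
  by_cases h : i ∈ J ω
  · refine iff_of_true (by_contra fun h' => h' ?_) h
    rwa [← hJ.apply_flipBit h', flipBit_involutive i ω]
  · rw [hJ.apply_flipBit h]

lemma Determines.indicator_hits_flipBit (hJ : Determines J J) {S : Finset ι} {i : ι} (hi : i ∈ S)
    (ω : ι → ℤˣ) :
    (hits J S).indicator (1 : (ι → ℤˣ) → ℝ) (flipBit i ω) = (hits J S).indicator 1 ω := by
  by_cases h : i ∈ J ω
  · have hω : ω ∈ hits J S := ⟨i, hi, h⟩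
    have hflip : flipBit i ω ∈ hits J S := ⟨i, hi, (hJ.mem_apply_flipBit i ω).2 h⟩
    simp only [Set.indicator_of_mem hω, Set.indicator_of_mem hflip, Pi.one_apply]
  · exact (hJ.indicator_hits S).apply_flipBit h

variable [Fintype ι]

lemma expect_mul_walsh_mul_hits {f : (ι → ℤˣ) → ℝ} (hJ : Determines J J) (hf : Determines J f)
    {S : Finset ι} (hS : S.Nonempty) :
    𝔼 ω, f ω * (walsh S ω * (hits J S).indicator 1 ω) = walshCoeff f S := by
  obtain ⟨i, hi⟩ := hS
  have expect_missed : 𝔼 ω, f ω * walsh S ω * (1 - (hits J S).indicator 1 ω) = 0 := by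
    refine expect_eq_zero_of_flipBit i _ fun ω => ?_
    rw [walsh_flipBit_of_mem hi, hJ.indicator_hits_flipBit hi]
    by_cases h : i ∈ J ω
    · simp [show ω ∈ hits J S from ⟨i, hi, h⟩]
    · rw [hf.apply_flipBit h]; ring
  rw [walshCoeff, ← sub_eq_zero, ← neg_eq_zero, ← expect_missed, neg_sub,
    ← Finset.expect_sub_distrib]
  exact Finset.expect_congr rfl fun ω _ => by ring

lemma expect_walsh_hits_mul_walsh_hits_eq_zero (hJ : Determines J J) {S T : Finset ι}
    (hST : S ≠ T) (hcard : S.card = T.card) :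
    𝔼 ω, (walsh S ω * (hits J S).indicator 1 ω) * (walsh T ω * (hits J T).indicator 1 ω) = 0 := by
  obtain ⟨i, hiS, hiT⟩ := Finset.not_subset.1 fun h =>
    hST (Finset.eq_of_subset_of_card_le h hcard.ge)
  obtain ⟨j, hjT, hjS⟩ := Finset.not_subset.1 fun h =>
    hST (Finset.eq_of_subset_of_card_le h hcard.le).symm
  set s : (ι → ℤˣ) → ℝ := (hits J S).indicator 1 with hs
  set t : (ι → ℤˣ) → ℝ := (hits J T).indicator 1 with ht
  have odd_i : 𝔼 ω, walsh S ω * s ω * walsh T ω = 0 := expect_eq_zero_of_flipBit i _ fun ω => by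
    rw [walsh_flipBit_of_mem hiS, walsh_flipBit_of_notMem hiT, hs, hJ.indicator_hits_flipBit hiS]
    ring
  have odd_j : 𝔼 ω, walsh S ω * (walsh T ω * (1 - t ω)) = 0 :=
    expect_eq_zero_of_flipBit j _ fun ω => by
      rw [walsh_flipBit_of_mem hjT, walsh_flipBit_of_notMem hjS, ht, hJ.indicator_hits_flipBit hjT]
      ring
  have odd_i_missed : 𝔼 ω, walsh S ω * (1 - s ω) * (walsh T ω * (1 - t ω)) = 0 := by
    refine expect_eq_zero_of_flipBit i _ fun ω => ?_
    rw [walsh_flipBit_of_mem hiS, walsh_flipBit_of_notMem hiT, hs, hJ.indicator_hits_flipBit hiS]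
    by_cases h : i ∈ J ω
    · simp [show ω ∈ hits J S from ⟨i, hiS, h⟩]
    · rw [ht, (hJ.indicator_hits T).apply_flipBit h]; ring
  calc 𝔼 ω, (walsh S ω * s ω) * (walsh T ω * t ω)
      = 𝔼 ω, (walsh S ω * s ω * walsh T ω - walsh S ω * (walsh T ω * (1 - t ω)) +
          walsh S ω * (1 - s ω) * (walsh T ω * (1 - t ω))) :=
        Finset.expect_congr rfl fun ω _ => by ring
    _ = 0 := by
        rw [Finset.expect_add_distrib, Finset.expect_sub_distrib, odd_i, odd_j, odd_i_missed]
        norm_num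

/-- The degree-`d` component of `f`, each of its characters being kept only where the random set
`J` meets the support of that character. -/
noncomputable def hittingPart (f : (ι → ℤˣ) → ℝ) (J : (ι → ℤˣ) → Set ι) (d : ℕ) (ω : ι → ℤˣ) : ℝ :=
  ∑ S ∈ Finset.univ.powersetCard d, walshCoeff f S * (walsh S ω * (hits J S).indicator 1 ω)

lemma expect_mul_hittingPart {f : (ι → ℤˣ) → ℝ} (hJ : Determines J J) (hf : Determines J f)
    {d : ℕ} (hd : d ≠ 0) : 𝔼 ω, f ω * hittingPart f J d ω = walshWeight f d := by
  simp only [hittingPart, Finset.mul_sum, mul_left_comm (f _) (walshCoeff f _)]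
  rw [Finset.expect_sum_comm]
  refine Finset.sum_congr rfl fun S hS => ?_
  have hS : S.Nonempty :=
    Finset.card_ne_zero.1 ((Finset.mem_powersetCard.1 hS).2.trans_ne hd)
  rw [← Finset.mul_expect, expect_mul_walsh_mul_hits hJ hf hS, sq]

lemma expect_hittingPart_sq (f : (ι → ℤˣ) → ℝ) (hJ : Determines J J) (d : ℕ) :
    𝔼 ω, hittingPart f J d ω ^ 2 =
      ∑ S ∈ Finset.univ.powersetCard d, walshCoeff f S ^ 2 * prob (hits J S) := by
  simp only [hittingPart, sq, Finset.sum_mul_sum, mul_mul_mul_comm (walshCoeff f _)]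
  rw [Finset.expect_sum_comm]
  refine Finset.sum_congr rfl fun S hS => ?_
  rw [Finset.expect_sum_comm, Finset.sum_eq_single_of_mem S hS]
  · rw [← Finset.mul_expect, prob]
    congr 1
    refine Finset.expect_congr rfl fun ω _ => ?_
    rw [mul_mul_mul_comm, walsh_mul_self, one_mul, ← Pi.mul_apply, ← Set.inter_indicator_one,
      Set.inter_self]
  · intro T hT hTS
    have hcard : S.card = T.card :=
      (Finset.mem_powersetCard.1 hS).2.trans (Finset.mem_powersetCard.1 hT).2.symm
    rw [← Finset.mul_expect, expect_walsh_hits_mul_walsh_hits_eq_zero hJ hTS.symm hcard, mul_zero]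

lemma walshWeight_sq_le {f : (ι → ℤˣ) → ℝ} (hf_sq : ∀ ω, f ω ^ 2 ≤ 1) (hJ : Determines J J)
    (hf : Determines J f) {d : ℕ} (hd : d ≠ 0) :
    walshWeight f d ^ 2 ≤
      ∑ S ∈ Finset.univ.powersetCard d, walshCoeff f S ^ 2 * prob (hits J S) := by
  rw [← expect_mul_hittingPart hJ hf hd, ← expect_hittingPart_sq f hJ]
  refine (Finset.expect_mul_sq_le_sq_mul_sq _ _ _).trans (mul_le_of_le_one_left ?_ ?_)
  · exact Finset.expect_nonneg fun _ _ => sq_nonneg _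
  · exact Finset.expect_le Finset.univ_nonempty fun ω _ => hf_sq ω

end Flip

variable [Fintype ι] [DecidableEq ι]

/-- Some randomized stopping set determines `f` and contains each input bit with probability at most
`δ`. The randomness is an auxiliary uniform seed, independent of the input. -/
def HasRevealmentLE (f : (ι → ℤˣ) → α) (δ : ℝ) : Prop :=
  ∃ (κ : Type) (_ : Fintype κ) (_ : Nonempty κ) (J : κ → (ι → ℤˣ) → Set ι),
    (∀ c, Determines (J c) (J c)) ∧ (∀ c, Determines (J c) f) ∧
      ∀ i, prob {x : κ × (ι → ℤˣ) | i ∈ J x.1 x.2} ≤ δ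

lemma HasRevealmentLE.of_factorsThrough {f : (ι → ℤˣ) → α} {β : Type*} {g : (ι → ℤˣ) → β} {δ : ℝ}
    (hf : HasRevealmentLE f δ) (hg : g.FactorsThrough f) : HasRevealmentLE g δ := by
  obtain ⟨κ, hκ, hκ', J, hJ, hJf, hδ⟩ := hf
  exact ⟨κ, hκ, hκ', J, hJ, fun c => (hJf c).of_factorsThrough hg, hδ⟩

theorem HasRevealmentLE.walshWeight_le {f : (ι → ℤˣ) → ℝ} {δ : ℝ} (h : HasRevealmentLE f δ)
    (hδ : 0 ≤ δ) (hf_sq : ∀ ω, f ω ^ 2 ≤ 1) {d : ℕ} (hd : d ≠ 0) : walshWeight f d ≤ d * δ := by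
  obtain ⟨κ, _, _, J, hJ, hf, hrev⟩ := h
  have expect_prob_hits (S : Finset ι) : 𝔼 c, prob (hits (J c) S) ≤ S.card * δ :=
    calc 𝔼 c, prob (hits (J c) S)
        = prob (⋃ i ∈ S, {x : κ × (ι → ℤˣ) | i ∈ J x.1 x.2}) := by
          rw [prob_eq_expect_section]
          refine Finset.expect_congr rfl fun c _ => congrArg prob ?_
          ext ω
          simp [hits]
      _ ≤ ∑ _i ∈ S, δ := (prob_biUnion_le _ _).trans (Finset.sum_le_sum fun i _ => hrev i)
      _ = S.card * δ := by rw [Finset.sum_const, nsmul_eq_mul]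
  have sq_le : walshWeight f d ^ 2 ≤ walshWeight f d * (d * δ) :=
    calc walshWeight f d ^ 2
        ≤ 𝔼 c, ∑ S ∈ Finset.univ.powersetCard d, walshCoeff f S ^ 2 * prob (hits (J c) S) :=
          Finset.le_expect Finset.univ_nonempty fun c _ => walshWeight_sq_le hf_sq (hJ c) (hf c) hd
      _ = ∑ S ∈ Finset.univ.powersetCard d, walshCoeff f S ^ 2 * 𝔼 c, prob (hits (J c) S) := by
          simp only [Finset.expect_sum_comm, Finset.mul_expect]
      _ ≤ ∑ S ∈ Finset.univ.powersetCard d, walshCoeff f S ^ 2 * (d * δ) := by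
          refine Finset.sum_le_sum fun S hS => mul_le_mul_of_nonneg_left ?_ (sq_nonneg _)
          rw [← (Finset.mem_powersetCard.1 hS).2]
          exact expect_prob_hits S
      _ = walshWeight f d * (d * δ) := (Finset.sum_mul _ _ _).symm
  rcases (walshWeight_nonneg f d).eq_or_lt with hzero | hpos
  · rw [← hzero]; positivity
  · exact le_of_mul_le_mul_left (sq (walshWeight f d) ▸ sq_le) hpos

end Revealment

section NoiseCovariance

instance isProbabilityMeasure_uniformBit : IsProbabilityMeasure uniformBit := ⟨by
  simp only [uniformBit, Measure.add_apply, Measure.smul_apply, measure_univ, smul_eq_mul, mul_one]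
  rw [← ENNReal.ofReal_add (by norm_num) (by norm_num)]
  norm_num⟩

variable {ε : ℝ}

lemma isProbabilityMeasure_noiseBit (h0 : 0 ≤ ε) (h1 : ε ≤ 1) :
    IsProbabilityMeasure (noiseBit ε) := ⟨by
  simp only [noiseBit, Measure.add_apply, Measure.smul_apply, measure_univ, smul_eq_mul, mul_one]
  rw [← ENNReal.ofReal_add (by linarith) h0, sub_add_cancel, ENNReal.ofReal_one]⟩

lemma uniformBit_eq_noiseBit : uniformBit = noiseBit (1 / 2) := by
  norm_num [uniformBit, noiseBit]

lemma integral_noiseBit (h0 : 0 ≤ ε) (h1 : ε ≤ 1) (g : ℤˣ → ℝ) :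
    ∫ u, g u ∂noiseBit ε = (1 - ε) * g 1 + ε * g (-1) := by
  have integrable_smul_dirac (u : ℤˣ) (a : ℝ) :
      Integrable g (ENNReal.ofReal a • Measure.dirac u) :=
    Integrable.of_finite.smul_measure ENNReal.ofReal_ne_top
  rw [noiseBit, integral_add_measure (integrable_smul_dirac _ _) (integrable_smul_dirac _ _),
    integral_smul_measure, integral_smul_measure, integral_dirac, integral_dirac,
    ENNReal.toReal_ofReal h0, ENNReal.toReal_ofReal (by linarith), smul_eq_mul, smul_eq_mul]

lemma integral_walsh_noiseBit {ι : Type*} [Fintype ι] (h0 : 0 ≤ ε) (h1 : ε ≤ 1) (S : Finset ι) :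
    ∫ ω, walsh S ω ∂(Measure.pi fun _ : ι => noiseBit ε) = (1 - 2 * ε) ^ S.card := by
  classical
  have := isProbabilityMeasure_noiseBit h0 h1
  simp only [walsh_eq_prod_univ]
  rw [integral_fintype_prod_eq_prod
    (f := fun i (u : ℤˣ) => if i ∈ S then ((u : ℤ) : ℝ) else 1)]
  simp only [integral_noiseBit h0 h1]
  rw [← Finset.prod_const, ← Finset.prod_subset (Finset.subset_univ S)]
  · exact Finset.prod_congr rfl fun i hi => by simp [hi]; ring
  · exact fun i _ hi => by simp [hi]

lemma integral_walsh_uniformBit {ι : Type*} [Fintype ι] (S : Finset ι) :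
    ∫ ω, walsh S ω ∂(Measure.pi fun _ : ι => uniformBit) = 0 ^ S.card := by
  rw [uniformBit_eq_noiseBit, integral_walsh_noiseBit (by norm_num) (by norm_num)]
  norm_num

variable {ι : Type} [Fintype ι] [DecidableEq ι]

lemma covariance_walsh_noiseLaw (h0 : 0 ≤ ε) (h1 : ε ≤ 1) (S T : Finset ι) :
    cov[fun p => walsh S p.1, fun p => walsh T (p.1 * p.2); noiseLaw ι ε] =
      if S = T ∧ S ≠ ∅ then (1 - 2 * ε) ^ S.card else 0 := by
  have := isProbabilityMeasure_noiseBit h0 h1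
  have integral_mul (U U' : Finset ι) :
      ∫ p, walsh U p.1 * walsh U' p.2 ∂noiseLaw ι ε = 0 ^ U.card * (1 - 2 * ε) ^ U'.card := by
    rw [noiseLaw, integral_prod_mul, integral_walsh_uniformBit, integral_walsh_noiseBit h0 h1]
  have integral_fst : ∫ p, walsh S p.1 ∂noiseLaw ι ε = 0 ^ S.card := by
    simpa [walsh] using integral_mul S ∅
  have : IsProbabilityMeasure (noiseLaw ι ε) := by unfold noiseLaw; infer_instance
  rw [covariance_eq_sub MemLp.of_discrete MemLp.of_discrete]
  simp only [Pi.mul_apply, walsh_mul, ← mul_assoc, walsh_mul_walsh]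
  rw [integral_mul, integral_mul, integral_fst]
  by_cases hST : S = T
  · subst hST
    by_cases hS : S = ∅ <;> simp [hS]
  · have : (symmDiff S T).card ≠ 0 := by simpa using hST
    by_cases hS : S = ∅ <;> by_cases hT : T = ∅ <;> simp_all

lemma noiseCov_eq_sum_walshCoeff (h0 : 0 ≤ ε) (h1 : ε ≤ 1) (f : (ι → ℤˣ) → ℤˣ) :
    noiseCov f ε = ∑ S : Finset ι with S ≠ ∅,
      walshCoeff (fun ω => ((f ω : ℤ) : ℝ)) S ^ 2 * (1 - 2 * ε) ^ S.card := by
  have := isProbabilityMeasure_noiseBit h0 h1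
  have : IsProbabilityMeasure (noiseLaw ι ε) := by unfold noiseLaw; infer_instance
  set a := walshCoeff fun ω => ((f ω : ℤ) : ℝ)
  have expansion (φ : (ι → ℤˣ) × (ι → ℤˣ) → ι → ℤˣ) :
      (fun p => ((f (φ p) : ℤ) : ℝ)) = ∑ S : Finset ι, a S • fun p => walsh S (φ p) := by
    ext p
    simpa using (sum_walshCoeff_mul_walsh (fun ω => ((f ω : ℤ) : ℝ)) (φ p)).symm
  rw [noiseCov, expansion fun p => p.1, expansion fun p => p.1 * p.2,
    covariance_sum_sum (fun _ => MemLp.of_discrete) fun _ => MemLp.of_discrete, Finset.sum_filter]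
  refine Finset.sum_congr rfl fun S _ => ?_
  simp only [covariance_smul_left, covariance_smul_right, covariance_walsh_noiseLaw h0 h1]
  rw [Finset.sum_eq_single_of_mem S (Finset.mem_univ S) fun T _ hT => by simp [hT.symm]]
  split_ifs <;> simp_all [sq, mul_assoc]

lemma noiseCov_eq_sum_walshWeight (h0 : 0 ≤ ε) (h1 : ε ≤ 1) (f : (ι → ℤˣ) → ℤˣ) :
    noiseCov f ε = ∑ d ∈ Finset.Icc 1 (Fintype.card ι),
      walshWeight (fun ω => ((f ω : ℤ) : ℝ)) d * (1 - 2 * ε) ^ d := by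
  rw [noiseCov_eq_sum_walshCoeff h0 h1, ← Finset.sum_fiberwise_of_maps_to
    (t := Finset.Icc 1 (Fintype.card ι)) (g := Finset.card)]
  · refine Finset.sum_congr rfl fun d hd => ?_
    have level_eq : {S ∈ ({S : Finset ι | S ≠ ∅} : Finset (Finset ι)) | S.card = d} =
        Finset.univ.powersetCard d := by
      ext S
      have := (Finset.mem_Icc.1 hd).1
      simp only [Finset.mem_filter, Finset.mem_univ, true_and, Finset.mem_powersetCard,
        Finset.subset_univ, ← Finset.card_ne_zero, ← Finset.nonempty_iff_ne_empty]
      omega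
    rw [level_eq, walshWeight, Finset.sum_mul]
    exact Finset.sum_congr rfl fun S hS => by rw [(Finset.mem_powersetCard.1 hS).2]
  · intro S hS
    have hS : S.Nonempty := Finset.nonempty_iff_ne_empty.2 (Finset.mem_filter.1 hS).2
    exact Finset.mem_Icc.2 ⟨hS.card_pos, Finset.card_le_univ S⟩

theorem HasRevealmentLE.abs_noiseCov_le {f : (ι → ℤˣ) → ℤˣ} {δ : ℝ} (h : HasRevealmentLE f δ)
    (hδ : 0 ≤ δ) (h0 : 0 < ε) (h1 : ε < 1) :
    |noiseCov f ε| ≤ δ * (|1 - 2 * ε| / (1 - |1 - 2 * ε|) ^ 2) := by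
  set g : (ι → ℤˣ) → ℝ := fun ω => ((f ω : ℤ) : ℝ)
  set ρ := |1 - 2 * ε| with hρ
  have hρ_norm : ‖ρ‖ < 1 := by
    rw [Real.norm_eq_abs, hρ, abs_abs, abs_lt]
    constructor <;> linarith
  have weight_le (d : ℕ) (hd : d ∈ Finset.Icc 1 (Fintype.card ι)) : walshWeight g d ≤ d * δ :=
    (h.of_factorsThrough fun ω η hωη => by rw [hωη]).walshWeight_le hδ
      (fun ω => (sq ((f ω : ℤ) : ℝ)).trans_le (cast_units_mul_self _).le)
      (Nat.one_le_iff_ne_zero.1 (Finset.mem_Icc.1 hd).1)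
  have summable_geometric : Summable fun d : ℕ => (d : ℝ) * ρ ^ d := by
    simpa using summable_pow_mul_geometric_of_norm_lt_one (R := ℝ) 1 hρ_norm
  calc |noiseCov f ε|
      ≤ ∑ d ∈ Finset.Icc 1 (Fintype.card ι), walshWeight g d * ρ ^ d := by
        rw [noiseCov_eq_sum_walshWeight h0.le h1.le]
        refine (Finset.abs_sum_le_sum_abs _ _).trans_eq (Finset.sum_congr rfl fun d _ => ?_)
        rw [abs_mul, abs_of_nonneg (walshWeight_nonneg g d), abs_pow]
    _ ≤ ∑ d ∈ Finset.Icc 1 (Fintype.card ι), δ * (d * ρ ^ d) := by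
        refine Finset.sum_le_sum fun d hd => ?_
        rw [mul_left_comm, ← mul_assoc]
        exact mul_le_mul_of_nonneg_right (weight_le d hd) (by positivity)
    _ ≤ δ * ∑' d : ℕ, d * ρ ^ d := by
        rw [← Finset.mul_sum]
        exact mul_le_mul_of_nonneg_left
          (summable_geometric.sum_le_tsum _ fun d _ => by positivity) hδ
    _ = δ * (ρ / (1 - ρ) ^ 2) := by rw [tsum_coe_mul_geometric_of_norm_lt_one hρ_norm]

end NoiseCovariance

theorem noiseSensitive_of_hasRevealmentLE {ι : ℕ → Type} [∀ n, Fintype (ι n)]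
    [∀ n, DecidableEq (ι n)] {f : ∀ n, (ι n → ℤˣ) → ℤˣ} {δ : ℕ → ℝ} (hδ_nonneg : ∀ n, 0 ≤ δ n)
    (hδ : Tendsto δ atTop (𝓝 0)) (hf : ∀ᶠ n in atTop, HasRevealmentLE (f n) (δ n)) :
    NoiseSensitive f := fun ε h0 h1 => by
  have bound_tendsto := hδ.mul_const (|1 - 2 * ε| / (1 - |1 - 2 * ε|) ^ 2)
  rw [zero_mul] at bound_tendsto
  refine squeeze_zero_norm' (hf.mono fun n hn => ?_) bound_tendsto
  exact hn.abs_noiseCov_le (hδ_nonneg n) h0 (by linarith)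

section Majority

variable {α β : Type*} {s : Finset α}

/-- The sign of the sum of the bits `x` over `s`, a tie being counted as `-1`. -/
def majority (s : Finset α) (x : α → ℤˣ) : ℤˣ := if 0 < ∑ u ∈ s, (x u : ℤ) then 1 else -1

lemma majority_eq_of_bijOn {t : Finset β} (e : α → β) (he : Set.BijOn e s t) {x : α → ℤˣ}
    {y : β → ℤˣ} (h : ∀ u ∈ s, x u = y (e u)) : majority s x = majority t y := by
  rw [majority, majority, Finset.sum_nbij (g := fun v => (y v : ℤ)) e he.mapsTo he.injOn
    he.surjOn fun u hu => by rw [h u hu]]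

lemma majority_congr {x y : α → ℤˣ} (h : Set.EqOn x y s) : majority s x = majority s y :=
  majority_eq_of_bijOn id (Set.bijOn_id _) h

lemma monotone_majority (s : Finset α) : Monotone (majority s) := fun x y hxy => by
  have sum_le : ∑ u ∈ s, (x u : ℤ) ≤ ∑ u ∈ s, (y u : ℤ) :=
    Finset.sum_le_sum fun u _ => Units.val_le_val.2 (hxy u)
  unfold majority
  split_ifs with hx hy
  · exact le_rfl
  · exact absurd (hx.trans_le sum_le) hy
  · decide
  · exact le_rfl

lemma sum_units_ne_zero (hs : Odd s.card) (x : α → ℤˣ) : ∑ u ∈ s, (x u : ℤ) ≠ 0 := fun hzero => by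
  have cast_eq_one (u : α) : ((x u : ℤ) : ZMod 2) = 1 := by
    rcases Int.units_eq_one_or (x u) with hu | hu <;> rw [hu] <;> decide
  have card_eq_zero : (s.card : ZMod 2) = 0 := by
    simpa [cast_eq_one] using congrArg (Int.cast : ℤ → ZMod 2) hzero
  exact Nat.not_even_iff_odd.2 hs ((ZMod.natCast_eq_zero_iff_even).1 card_eq_zero)

lemma majority_neg (hs : Odd s.card) (x : α → ℤˣ) : majority s (-x) = -majority s x := by
  have := sum_units_ne_zero hs x
  simp only [majority, Pi.neg_apply, Units.val_neg, Finset.sum_neg_distrib]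
  split_ifs <;> first | rfl | omega

lemma majority_eq_of_forall_ne (hs : 3 ≤ s.card) {x : α → ℤˣ} {a : ℤˣ} (u : α)
    (h : ∀ t ∈ s, t ≠ u → x t = a) : majority s x = a := by
  classical
  have hcard : (2 : ℤ) ≤ (s.erase u).card := by
    have := Finset.pred_card_le_card_erase (s := s) (a := u)
    omega
  have sum_others : ∑ t ∈ s.erase u, (x t : ℤ) = (s.erase u).card * a := by
    rw [Finset.sum_congr rfl fun t ht => congrArg Units.val (h t (Finset.mem_of_mem_erase ht)
      (Finset.ne_of_mem_erase ht)), Finset.sum_const, nsmul_eq_mul]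
  have sum_le : |∑ t ∈ s, (x t : ℤ) - (s.erase u).card * a| ≤ 1 := by
    by_cases hu : u ∈ s
    · rw [← Finset.add_sum_erase s _ hu, sum_others]
      rcases Int.units_eq_one_or (x u) with hx | hx <;> simp [hx]
    · rw [← sum_others, Finset.erase_eq_of_notMem hu]
      simp
  rw [abs_le] at sum_le
  unfold majority
  rcases Int.units_eq_one_or a with rfl | rfl
  · exact if_pos (by simp only [Units.val_one] at sum_le; linarith)
  · exact if_neg (by simp only [Units.val_neg, Units.val_one] at sum_le; linarith)

end Majority

section IntegerModel

/-- The children, in the layer below, of node `j` of the stride-two graph on the integers. -/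
noncomputable abbrev strideChildren (j : ℤ) : Finset ℤ := Finset.Icc (2 * j - 1) (2 * j + 1)

lemma card_strideChildren (j : ℤ) : (strideChildren j).card = 3 := by
  rw [Int.card_Icc]; omega

/-- The value of node `j` of layer `k` of the iterated 3-majority with stride two, on the integers,
with input `w`. -/
noncomputable def strideMaj (w : ℤ → ℤˣ) : ℕ → ℤ → ℤˣ
  | 0, j => w j
  | k + 1, j => majority (strideChildren j) (strideMaj w k)

lemma monotone_strideMaj : ∀ k : ℕ, Monotone fun w => strideMaj w k
  | 0 => monotone_id
  | k + 1 => fun _ _ h j => monotone_majority (strideChildren j) (monotone_strideMaj k h)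

lemma strideMaj_neg (w : ℤ → ℤˣ) : ∀ k : ℕ, strideMaj (-w) k = -strideMaj w k
  | 0 => rfl
  | k + 1 => funext fun j => by
    rw [strideMaj, strideMaj_neg w k, majority_neg (by rw [card_strideChildren]; decide)]
    rfl

lemma strideMaj_succ_eq_of_forall_ne {w : ℤ → ℤˣ} {k : ℕ} {j : ℤ} {a : ℤˣ} (u : ℤ)
    (h : ∀ t ∈ strideChildren j, t ≠ u → strideMaj w k t = a) : strideMaj w (k + 1) j = a :=
  majority_eq_of_forall_ne (card_strideChildren j).ge u h

/-- The children of `j` that are evaluated when the coin of their layer is `c`: all of them, except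
that the child of residue `c` modulo `4`, if there is one, is skipped when its siblings agree. -/
def consulted (c : ZMod 4) (j : ℤ) (x : ℤ → ℤˣ) : Set ℤ :=
  {u | u ∈ strideChildren j ∧ ((u : ZMod 4) = c →
    ∃ s ∈ strideChildren j, ∃ t ∈ strideChildren j, s ≠ u ∧ t ≠ u ∧ x s ≠ x t)}

lemma mem_consulted_of_ne {c : ZMod 4} {j u t : ℤ} (hu : u ∈ strideChildren j)
    (huc : (u : ZMod 4) = c) (ht : t ∈ strideChildren j) (htu : t ≠ u) (x : ℤ → ℤˣ) :
    t ∈ consulted c j x := by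
  refine ⟨ht, fun htc => absurd ?_ htu⟩
  have : (t : ZMod 4) = u := htc.trans huc.symm
  rw [ZMod.intCast_eq_intCast_iff_dvd_sub] at this
  rw [Finset.mem_Icc] at hu ht
  omega

lemma siblings_agree_of_notMem_consulted {c : ZMod 4} {j u : ℤ} (hu : u ∈ strideChildren j)
    {x : ℤ → ℤˣ} (h : u ∉ consulted c j x) :
    (u : ZMod 4) = c ∧ ∃ a, ∀ t ∈ strideChildren j, t ≠ u → x t = a := by
  simp only [consulted, Set.mem_ofPred_eq, hu, true_and] at h
  push Not at h
  obtain ⟨huc, agree⟩ := h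
  obtain ⟨s, hs, hsu⟩ := Finset.exists_mem_ne (s := strideChildren j)
    (by rw [card_strideChildren]; norm_num) u
  exact ⟨huc, x s, fun t ht htu => (agree s hs t ht hsu htu).symm⟩

lemma eqOn_strideChildren_or_exists_skipped {c : ZMod 4} {j : ℤ} {x y : ℤ → ℤˣ}
    (h : Set.EqOn x y (consulted c j x)) :
    Set.EqOn x y (strideChildren j) ∨ ∃ u ∈ strideChildren j, (u : ZMod 4) = c ∧
      ∃ a, ∀ t ∈ strideChildren j, t ≠ u → x t = a ∧ y t = a := by
  by_cases hall : ∀ u ∈ strideChildren j, u ∈ consulted c j x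
  · exact Or.inl fun u hu => h (hall u hu)
  · push Not at hall
    obtain ⟨u, hu, hskip⟩ := hall
    obtain ⟨huc, a, ha⟩ := siblings_agree_of_notMem_consulted hu hskip
    refine Or.inr ⟨u, hu, huc, a, fun t ht htu => ⟨ha t ht htu, ?_⟩⟩
    rw [← h (mem_consulted_of_ne hu huc ht htu x), ha t ht htu]

lemma determines_consulted_majority (c : ZMod 4) (j : ℤ) :
    Determines (consulted c j) (majority (strideChildren j)) := fun x y h => by
  rcases eqOn_strideChildren_or_exists_skipped h with hall | ⟨u, -, -, a, ha⟩
  · exact (majority_congr hall).symm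
  · rw [majority_eq_of_forall_ne (card_strideChildren j).ge u fun t ht htu => (ha t ht htu).1,
      majority_eq_of_forall_ne (card_strideChildren j).ge u fun t ht htu => (ha t ht htu).2]

lemma determines_consulted_consulted (c : ZMod 4) (j : ℤ) :
    Determines (consulted c j) (consulted c j) := fun x y h => by
  rcases eqOn_strideChildren_or_exists_skipped h with hall | ⟨u, hu, huc, a, ha⟩
  · ext v
    refine and_congr_right fun _ => imp_congr_right fun _ => ?_
    refine exists_congr fun s => and_congr_right fun hs => exists_congr fun t =>
      and_congr_right fun ht => ?_
    rw [hall hs, hall ht]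
  · ext v
    by_cases hvu : v = u
    · subst hvu
      refine and_congr_right fun _ => imp_congr_right fun _ => ?_
      refine exists_congr fun s => and_congr_right fun hs => exists_congr fun t =>
        and_congr_right fun ht => and_congr_right fun hsv => and_congr_right fun htv => ?_
      rw [(ha s hs hsv).1, (ha s hs hsv).2, (ha t ht htv).1, (ha t ht htv).2]
    · by_cases hv : v ∈ strideChildren j
      · exact iff_of_true (mem_consulted_of_ne hu huc hv hvu y)
          (mem_consulted_of_ne hu huc hv hvu x)
      · exact iff_of_false (fun h => hv h.1) fun h => hv h.1

/-- The input sites read by the recursive evaluation of node `j` of layer `k`, the coin of layer `i`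
being `c i`. -/
def revealed (c : ℕ → ZMod 4) : ℕ → ℤ → (ℤ → ℤˣ) → Set ℤ
  | 0, j, _ => {j}
  | k + 1, j, w => ⋃ u ∈ consulted (c k) j (strideMaj w k), revealed c k u w

lemma mem_revealed_succ {c : ℕ → ZMod 4} {k : ℕ} {j x : ℤ} {w : ℤ → ℤˣ} :
    x ∈ revealed c (k + 1) j w ↔ ∃ u ∈ consulted (c k) j (strideMaj w k), x ∈ revealed c k u w := by
  simp [revealed]

lemma revealed_subset_revealed_succ {c : ℕ → ZMod 4} {k : ℕ} {j u : ℤ} {w : ℤ → ℤˣ}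
    (hu : u ∈ consulted (c k) j (strideMaj w k)) : revealed c k u w ⊆ revealed c (k + 1) j w :=
  fun _ hx => mem_revealed_succ.2 ⟨u, hu, hx⟩

lemma determines_revealed (c : ℕ → ZMod 4) (k : ℕ) : ∀ j : ℤ,
    Determines (revealed c k j) (fun w => strideMaj w k j) ∧
      Determines (revealed c k j) (revealed c k j) := by
  induction k with
  | zero => exact fun j => ⟨fun w w' h => (h rfl).symm, fun w w' _ => rfl⟩
  | succ k ih =>
    intro j
    have eqOn_consulted {w w' : ℤ → ℤˣ} (h : Set.EqOn w w' (revealed c (k + 1) j w)) :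
        Set.EqOn (strideMaj w k) (strideMaj w' k) (consulted (c k) j (strideMaj w k)) :=
      fun u hu => ((ih u).1 (h.mono (revealed_subset_revealed_succ hu))).symm
    refine ⟨fun w w' h => determines_consulted_majority _ _ (eqOn_consulted h), fun w w' h => ?_⟩
    rw [revealed, determines_consulted_consulted _ _ (eqOn_consulted h)]
    exact Set.iUnion₂_congr fun u hu => (ih u).2 (h.mono (revealed_subset_revealed_succ hu))

lemma determines_revealed_strideMaj (c : ℕ → ZMod 4) (k : ℕ) (j : ℤ) :
    Determines (revealed c k j) fun w => strideMaj w k j :=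
  (determines_revealed c k j).1

lemma determines_revealed_revealed (c : ℕ → ZMod 4) (k : ℕ) (j : ℤ) :
    Determines (revealed c k j) (revealed c k j) :=
  (determines_revealed c k j).2

lemma revealed_congr_coins {c c' : ℕ → ZMod 4} (w : ℤ → ℤˣ) : ∀ {k : ℕ} (j : ℤ),
    Set.EqOn c c' (Set.Iio k) → revealed c k j w = revealed c' k j w
  | 0, _, _ => rfl
  | k + 1, j, h => by
    rw [revealed, revealed, h k.lt_succ_self]
    exact Set.iUnion₂_congr fun u _ =>
      revealed_congr_coins w u (h.mono (Set.Iio_subset_Iio k.le_succ))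

/-- The input sites on which the value of node `j` of layer `k` may depend. -/
def cone (k : ℕ) (j : ℤ) : Set ℤ := Set.Ioo (2 ^ k * (j - 1)) (2 ^ k * (j + 1))

lemma cone_subset_cone_succ (k : ℕ) {j u : ℤ} (hu : u ∈ strideChildren j) :
    cone k u ⊆ cone (k + 1) j := by
  rw [Finset.mem_Icc] at hu
  refine Set.Ioo_subset_Ioo ?_ ?_
  · rw [pow_succ, mul_assoc]
    exact mul_le_mul_of_nonneg_left (by linarith) (by positivity)
  · rw [pow_succ, mul_assoc]
    exact mul_le_mul_of_nonneg_left (by linarith) (by positivity)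

lemma revealed_subset_cone (c : ℕ → ZMod 4) (w : ℤ → ℤˣ) : ∀ (k : ℕ) (j : ℤ),
    revealed c k j w ⊆ cone k j
  | 0, j => by simp [revealed, cone]
  | k + 1, _ => Set.iUnion₂_subset fun u hu =>
    (revealed_subset_cone c w k u).trans (cone_subset_cone_succ k hu.1)

lemma strideMaj_congr_cone {k : ℕ} {j : ℤ} {w w' : ℤ → ℤˣ} (h : Set.EqOn w w' (cone k j)) :
    strideMaj w k j = strideMaj w' k j :=
  (determines_revealed_strideMaj 0 k j (h.mono (revealed_subset_cone 0 w k j))).symm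

lemma eq_ediv_or_eq_ediv_add_one_of_mem_cone {k : ℕ} {j x : ℤ} (h : x ∈ cone k j) :
    j = x / 2 ^ k ∨ j = x / 2 ^ k + 1 := by
  have two_pow_pos : (0 : ℤ) < 2 ^ k := by positivity
  have le_div : j - 1 ≤ x / 2 ^ k := (Int.le_ediv_iff_mul_le two_pow_pos).2 (by linarith [h.1])
  have div_lt : x / 2 ^ k < j + 1 := (Int.ediv_lt_iff_lt_mul two_pow_pos).2 (by linarith [h.2])
  omega

/-- The input sites read when all the nodes of layer `k` are evaluated. -/
def exposed (c : ℕ → ZMod 4) (k : ℕ) (w : ℤ → ℤˣ) : Set ℤ := ⋃ j, revealed c k j w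

lemma revealed_subset_exposed (c : ℕ → ZMod 4) (k : ℕ) (j : ℤ) (w : ℤ → ℤˣ) :
    revealed c k j w ⊆ exposed c k w :=
  Set.subset_iUnion (fun j => revealed c k j w) j

lemma exposed_antitone (c : ℕ → ZMod 4) (w : ℤ → ℤˣ) : Antitone fun k => exposed c k w :=
  antitone_nat_of_succ_le fun k => Set.iUnion_subset fun _ => Set.iUnion₂_subset fun u _ =>
    revealed_subset_exposed c k u w

lemma determines_exposed_strideMaj (c : ℕ → ZMod 4) (k : ℕ) :
    Determines (exposed c k) fun w => strideMaj w k := fun _ _ h =>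
  funext fun j => determines_revealed_strideMaj c k j (h.mono (revealed_subset_exposed c k j _))

lemma determines_exposed_exposed (c : ℕ → ZMod 4) (k : ℕ) :
    Determines (exposed c k) (exposed c k) := fun _ _ h =>
  Set.iUnion_congr fun j =>
    determines_revealed_revealed c k j (h.mono (revealed_subset_exposed c k j _))

/-- The input sites that can influence whether `x` is exposed at layer `k`. -/
def exposureZone (k : ℕ) (x : ℤ) : Set ℤ :=
  Set.Ioo (2 ^ k * (x / 2 ^ k - 1)) (2 ^ k * (x / 2 ^ k + 2))

lemma cone_subset_exposureZone {k : ℕ} {j x : ℤ} (h : x ∈ cone k j) :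
    cone k j ⊆ exposureZone k x := by
  have two_pow_nonneg : (0 : ℤ) ≤ 2 ^ k := by positivity
  refine Set.Ioo_subset_Ioo (mul_le_mul_of_nonneg_left ?_ two_pow_nonneg)
    (mul_le_mul_of_nonneg_left ?_ two_pow_nonneg) <;>
  rcases eq_ediv_or_eq_ediv_add_one_of_mem_cone h with hj | hj <;> omega

lemma mem_exposed_congr {c c' : ℕ → ZMod 4} {w w' : ℤ → ℤˣ} {k : ℕ} {x : ℤ}
    (hc : Set.EqOn c c' (Set.Iio k)) (hw : Set.EqOn w w' (exposureZone k x)) :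
    x ∈ exposed c k w ↔ x ∈ exposed c' k w' := by
  have mem_of_mem {c c' : ℕ → ZMod 4} {w w' : ℤ → ℤˣ} (hc : Set.EqOn c c' (Set.Iio k))
      (hw : Set.EqOn w w' (exposureZone k x)) (hx : x ∈ exposed c k w) : x ∈ exposed c' k w' := by
    obtain ⟨j, hj⟩ := Set.mem_iUnion.1 hx
    have subset_cone := revealed_subset_cone c w k j
    refine Set.mem_iUnion.2 ⟨j, ?_⟩
    rwa [← revealed_congr_coins w' j hc, determines_revealed_revealed c k j
      (hw.mono (subset_cone.trans (cone_subset_exposureZone (subset_cone hj))))]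
  exact ⟨mem_of_mem hc hw, mem_of_mem hc.symm hw.symm⟩

lemma disjoint_cone_exposureZone {k : ℕ} {j x : ℤ}
    (hj : j ∉ Finset.Icc (x / 2 ^ k - 1) (x / 2 ^ k + 2)) :
    Disjoint (cone k j) (exposureZone k x) := by
  have two_pow_nonneg : (0 : ℤ) ≤ 2 ^ k := by positivity
  rw [Set.disjoint_left]
  intro y hy hy'
  rw [Finset.mem_Icc, not_and_or, not_le, not_le] at hj
  rcases hj with hj | hj
  · linarith [hy.2, hy'.1,
      mul_le_mul_of_nonneg_left (show j + 1 ≤ x / 2 ^ k - 1 by omega) two_pow_nonneg]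
  · linarith [hy.1, hy'.2,
      mul_le_mul_of_nonneg_left (show x / 2 ^ k + 2 ≤ j - 1 by omega) two_pow_nonneg]

end IntegerModel

section Translation

lemma add_mem_strideChildren_add {j u p : ℤ} :
    u + 2 * p ∈ strideChildren (j + p) ↔ u ∈ strideChildren j := by
  simp only [Finset.mem_Icc]
  omega

lemma strideMaj_translate (p : ℤ) (w : ℤ → ℤˣ) (k : ℕ) (j : ℤ) :
    strideMaj (fun y => w (y + 2 ^ k * p)) k j = strideMaj w k (j + p) := by
  induction k generalizing p j with
  | zero => simp [strideMaj]
  | succ k ih =>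
    rw [pow_succ]
    simp only [mul_assoc, strideMaj]
    refine majority_eq_of_bijOn (· + 2 * p) ?_ fun u _ => ih (2 * p) u
    exact Set.BijOn.mk (fun u hu => add_mem_strideChildren_add.2 hu) (add_left_injective _).injOn
      fun u hu => ⟨u - 2 * p, by
        rw [Finset.mem_coe, ← add_mem_strideChildren_add (p := p), sub_add_cancel]
        exact hu, sub_add_cancel _ _⟩

lemma exists_add_mem_strideChildren_add {j p : ℤ} {P : ℤ → Prop} :
    (∃ s ∈ strideChildren (j + p), P s) ↔ ∃ s ∈ strideChildren j, P (s + 2 * p) := by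
  refine ⟨fun ⟨s, hs, h⟩ => ⟨s - 2 * p, ?_, ?_⟩, fun ⟨s, hs, h⟩ =>
    ⟨s + 2 * p, add_mem_strideChildren_add.2 hs, h⟩⟩
  · rwa [← add_mem_strideChildren_add (p := p), sub_add_cancel]
  · rwa [sub_add_cancel]

lemma mem_consulted_translate {c : ZMod 4} {j u q : ℤ} {x y : ℤ → ℤˣ}
    (h : ∀ v, x v = y (v + 2 * (2 * q))) :
    u ∈ consulted c j x ↔ u + 2 * (2 * q) ∈ consulted c (j + 2 * q) y := by
  refine and_congr add_mem_strideChildren_add.symm (imp_congr ?_ ?_)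
  · have four_eq_zero : ((4 : ℤ) : ZMod 4) = 0 := by decide
    rw [← mul_assoc, Int.cast_add, Int.cast_mul, show (2 * 2 : ℤ) = 4 by norm_num, four_eq_zero,
      zero_mul, add_zero]
  · simp only [exists_add_mem_strideChildren_add, h, ne_eq, add_left_inj]

lemma mem_revealed_translate (c : ℕ → ZMod 4) (w : ℤ → ℤˣ) (k : ℕ) (j y q : ℤ) :
    y ∈ revealed c k j (fun z => w (z + 2 ^ k * (2 * q))) ↔
      y + 2 ^ k * (2 * q) ∈ revealed c k (j + 2 * q) w := by
  induction k generalizing j q with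
  | zero => simp [revealed]
  | succ k ih =>
    have consulted_iff (u : ℤ) := mem_consulted_translate (c := c k) (j := j) (u := u)
      fun v => strideMaj_translate (2 * (2 * q)) w k v
    have shift : (2 : ℤ) ^ (k + 1) * (2 * q) = 2 ^ k * (2 * (2 * q)) := by ring
    simp only [mem_revealed_succ, shift, consulted_iff, ih]
    exact (Equiv.addRight (2 * (2 * q))).exists_congr_left.trans (exists_congr fun u => by simp)

lemma mem_exposed_translate (c : ℕ → ZMod 4) (w : ℤ → ℤˣ) (k : ℕ) (y q : ℤ) :
    y ∈ exposed c k (fun z => w (z + 2 ^ k * (2 * q))) ↔ y + 2 ^ k * (2 * q) ∈ exposed c k w := by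
  simp only [exposed, Set.mem_iUnion, mem_revealed_translate]
  exact (Equiv.addRight (2 * q)).exists_congr_left.trans (exists_congr fun j => by simp)

end Translation

section Blocking

variable {c : ℕ → ZMod 4} {k : ℕ} {w : ℤ → ℤˣ}

lemma strideMaj_succ_eq_one_of_siblings {a : ℤ}
    (hw : ∀ j ∈ Finset.Icc (8 * (a / 8) - 7) (8 * (a / 8) + 15),
      j ∉ Finset.Icc (a - 1) (a + 2) → strideMaj w k j = 1) {b : ℤ}
    (hb : b ∈ Finset.Icc (4 * (a / 8) - 3) (4 * (a / 8) + 7)) (hba : b ≠ a / 2)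
    (hba' : b ≠ a / 2 + 1) : strideMaj w (k + 1) b = 1 := by
  refine strideMaj_succ_eq_of_forall_ne (if b < a / 2 then a - 1 else a + 2) fun t ht htu => ?_
  simp only [Finset.mem_Icc] at *
  exact hw t (by omega) (by split_ifs at htu <;> omega)

lemma strideMaj_succ_succ_eq_one_of_siblings {b : ℤ}
    (hw : ∀ j ∈ Finset.Icc (4 * (b / 4) - 3) (4 * (b / 4) + 7), j ≠ b → j ≠ b + 1 →
      strideMaj w k j = 1) {d : ℤ}
    (hd : d ∈ Finset.Icc (2 * (b / 4) - 1) (2 * (b / 4) + 3)) (hdb : d ≠ b - b / 2) :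
    strideMaj w (k + 1) d = 1 := by
  refine strideMaj_succ_eq_of_forall_ne (2 * (b / 2) + 1) fun t ht htu => ?_
  simp only [Finset.mem_Icc] at *
  exact hw t (by omega) (by omega) (by omega)

lemma notMem_consulted_of_forall_ne {e : ZMod 4} {j u : ℤ} {x : ℤ → ℤˣ} (hu : (u : ZMod 4) = e)
    {a : ℤˣ} (h : ∀ t ∈ strideChildren j, t ≠ u → x t = a) : u ∉ consulted e j x := fun hmem => by
  obtain ⟨s, hs, t, ht, hsu, htu, hne⟩ := hmem.2 hu
  exact hne ((h s hs hsu).trans (h t ht htu).symm)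

lemma notMem_exposed_add_three {x a : ℤ} (ha : a = x / 2 ^ k)
    (hw : ∀ j ∈ Finset.Icc (8 * (a / 8) - 7) (8 * (a / 8) + 15),
      j ∉ Finset.Icc (a - 1) (a + 2) → strideMaj w k j = 1)
    (hc₁ : c (k + 1) = (2 * (a / 4) + 1 : ℤ)) (hc₂ : c (k + 2) = (a / 2 - a / 4 : ℤ)) :
    x ∉ exposed c (k + 3) w := fun hx => by
  -- `d := a / 2 - a / 4` is the only parent of the even one of the nodes `a / 2` and `a / 2 + 1`
  -- above `x`. So, once `d` is skipped, only the odd one, `2 * (a / 4) + 1`, could expose `x`; it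
  -- is skipped too, because its siblings under any parent other than `d` have the value `1`.
  have layer_one {b : ℤ} := strideMaj_succ_eq_one_of_siblings hw (b := b)
  have layer_two {d : ℤ} := strideMaj_succ_succ_eq_one_of_siblings (b := a / 2) (w := w)
    (k := k + 1) (fun j hj => layer_one (by rwa [Int.ediv_ediv_of_nonneg (by norm_num)] at hj))
    (d := d)
  rw [Int.ediv_ediv_of_nonneg (by norm_num), Int.ediv_ediv_of_nonneg (by norm_num)] at layer_two
  obtain ⟨j₃, hj₃⟩ := Set.mem_iUnion.1 hx
  obtain ⟨j₂, hj₂, hx₂⟩ := mem_revealed_succ.1 hj₃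
  obtain ⟨j₁, hj₁, hx₁⟩ := mem_revealed_succ.1 hx₂
  obtain ⟨j₀, hj₀, hx₀⟩ := mem_revealed_succ.1 hx₁
  have hj₀a := eq_ediv_or_eq_ediv_add_one_of_mem_cone (revealed_subset_cone c w k j₀ hx₀)
  rw [← ha] at hj₀a
  have hj₀_mem := Finset.mem_Icc.1 hj₀.1
  have hj₁_mem := Finset.mem_Icc.1 hj₁.1
  have hj₂_mem := Finset.mem_Icc.1 hj₂.1
  have hj₂_ne : j₂ ≠ a / 2 - a / 4 := fun h =>
    notMem_consulted_of_forall_ne (by rw [h, hc₂]) (fun t ht htj => layer_two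
      (by simp only [Finset.mem_Icc] at ht ⊢; omega) (h ▸ htj)) hj₂
  have hj₁_eq : j₁ = 2 * (a / 4) + 1 := by omega
  refine notMem_consulted_of_forall_ne (by rw [hj₁_eq, hc₁])
    (fun t ht htj => layer_one ?_ ?_ ?_) hj₁
  all_goals simp only [Finset.mem_Icc] at *; omega

end Blocking

section Unfolding

variable {ι : Type} {π : ℤ → Option ι} {N : ℤ} {K k : ℕ} {x : ℤ}

/-- The input on the integers that reads the bit `i` of `ω` wherever `π` takes the value `some i`,
and is `1` where `π` is undefined. -/
def pullInput (π : ℤ → Option ι) (ω : ι → ℤˣ) (y : ℤ) : ℤˣ := (π y).elim 1 ω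

lemma eqOn_pullInput {ω η : ι → ℤˣ} {A : Set ℤ}
    (h : ∀ y ∈ A, ∀ i, π y = some i → ω i = η i) :
    Set.EqOn (pullInput π ω) (pullInput π η) A := fun y hy => by
  unfold pullInput
  cases hi : π y with
  | none => rfl
  | some i => exact h y hy i hi

lemma monotone_pullInput (π : ℤ → Option ι) : Monotone (pullInput π) := fun ω η h y => by
  unfold pullInput
  cases π y with
  | none => exact le_rfl
  | some i => exact h i

lemma neg_pullInput_le (π : ℤ → Option ι) (ω : ι → ℤˣ) :
    -pullInput π ω ≤ pullInput π (-ω) := fun y => by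
  simp only [pullInput, Pi.neg_apply]
  cases π y with
  | none => exact (by decide : (-1 : ℤˣ) ≤ 1)
  | some i => exact le_rfl

lemma eq_one_of_one_le : ∀ {u : ℤˣ}, 1 ≤ u → u = 1 := by decide

lemma isUpperSet_strideMaj_eq_one (π : ℤ → Option ι) (k : ℕ) (j : ℤ) :
    IsUpperSet {ω | strideMaj (pullInput π ω) k j = 1} := fun _ _ h hω =>
  eq_one_of_one_le (hω.symm.trans_le (monotone_strideMaj k (monotone_pullInput π h) j))

/-- `π` lays the bits `ι` out on the integers, repetitions of the same bit being translates, by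
multiples of `N`, along which the whole layout is periodic. -/
structure IsUnfolding (N : ℤ) (π : ℤ → Option ι) : Prop where
  dvd_sub : ∀ {y z : ℤ} {i : ι}, π y = some i → π z = some i → N ∣ z - y
  periodic : ∀ {y z : ℤ} {i : ι}, π y = some i → π z = some i → Function.Periodic π (z - y)

lemma IsUnfolding.eq_of_mem_Ioo (hπ : IsUnfolding N π) {a b : ℤ} (hab : b ≤ a + N) {y z : ℤ}
    (hy : y ∈ Set.Ioo a b) (hz : z ∈ Set.Ioo a b) {i : ι} (hyi : π y = some i)
    (hzi : π z = some i) : y = z := by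
  have abs_sub_lt : |z - y| < N := by
    rw [abs_lt]
    constructor <;> linarith [hy.1, hy.2, hz.1, hz.2]
  linarith [Int.eq_zero_of_abs_lt_dvd (hπ.dvd_sub hyi hzi) abs_sub_lt]

lemma IsUnfolding.mem_exposed_iff (hπ : IsUnfolding (2 ^ (K + 2)) π) (c : ℕ → ZMod 4)
    (ω : ι → ℤˣ) {y z : ℤ} {i : ι} (hy : π y = some i) (hz : π z = some i) :
    y ∈ exposed c K (pullInput π ω) ↔ z ∈ exposed c K (pullInput π ω) := by
  obtain ⟨q, hq⟩ := hπ.dvd_sub hy hz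
  have shift : z - y = 2 ^ K * (2 * (2 * q)) := by rw [hq]; ring
  have pull_periodic : (fun t => pullInput π ω (t + 2 ^ K * (2 * (2 * q)))) = pullInput π ω :=
    funext fun t => congrArg (Option.elim · 1 ω) (shift ▸ hπ.periodic hy hz t)
  have := mem_exposed_translate c (pullInput π ω) K y (2 * q)
  rwa [pull_periodic, ← shift, add_sub_cancel] at this

/-- An infinite sequence of coins from finitely many, those of index at least `K` being `0`. -/
def extendCoins (c : Fin K → ZMod 4) (i : ℕ) : ZMod 4 := if h : i < K then c ⟨i, h⟩ else 0

lemma extendCoins_of_lt (c : Fin K → ZMod 4) {i : ℕ} (h : i < K) :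
    extendCoins c i = c ⟨i, h⟩ := dif_pos h

variable (π) in
/-- The set of seeds and inputs for which the site `x` is read in evaluating the nodes of layer
`k`. -/
def exposedEvent (K k : ℕ) (x : ℤ) : Set ((Fin K → ZMod 4) × (ι → ℤˣ)) :=
  {s | x ∈ exposed (extendCoins s.1) k (pullInput π s.2)}

/-- The nodes, other than the few that may read a site below node `a`, whose values decide whether
such a site can still be exposed three layers higher. -/
noncomputable def blockingNodes (a : ℤ) : Finset ℤ :=
  Finset.Icc (8 * (a / 8) - 7) (8 * (a / 8) + 15) \ Finset.Icc (a - 1) (a + 2)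

lemma card_blockingNodes (a : ℤ) : (blockingNodes a).card = 19 := by
  rw [blockingNodes, Finset.card_sdiff_of_subset (Finset.Icc_subset_Icc (by omega) (by omega)),
    Int.card_Icc, Int.card_Icc]
  omega

/-- The inputs for which all the nodes `blockingNodes a` of layer `k` have value `1`. -/
def blockingInputs (π : ℤ → Option ι) (k : ℕ) (a : ℤ) : Set (ι → ℤˣ) :=
  ⋂ j ∈ blockingNodes a, {ω | strideMaj (pullInput π ω) k j = 1}

/-- The seeds that delay the right nodes of layers `k + 1` and `k + 2` for `blockingInputs` to
block. -/
def blockingCoins (K k : ℕ) (a : ℤ) : Set (Fin K → ZMod 4) :=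
  {c | extendCoins c (k + 1) = (2 * (a / 4) + 1 : ℤ) ∧ extendCoins c (k + 2) = (a / 2 - a / 4 : ℤ)}

lemma exposedEvent_antitone (K : ℕ) (x : ℤ) : Antitone fun k => exposedEvent π K k x :=
  fun _ _ h _ hs => exposed_antitone _ _ h hs

lemma exposedEvent_add_three_subset (K k : ℕ) (x : ℤ) :
    exposedEvent π K (k + 3) x ⊆ exposedEvent π K k x \
      blockingCoins K k (x / 2 ^ k) ×ˢ blockingInputs π k (x / 2 ^ k) := by
  refine Set.subset_sdiff.2 ⟨exposedEvent_antitone K x (k.le_add_right 3), ?_⟩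
  refine Set.disjoint_left.2 fun s hs ⟨hc, hω⟩ =>
    notMem_exposed_add_three rfl (fun j hj hja => ?_) hc.1 hc.2 hs
  exact Set.mem_iInter₂.1 hω j (Finset.mem_sdiff.2 ⟨hj, hja⟩)

lemma cone_subset_of_mem_blockingNodes {a j : ℤ} (hj : j ∈ blockingNodes a) (k : ℕ) :
    cone k j ⊆ Set.Ioo (2 ^ k * (8 * (a / 8) - 8)) (2 ^ k * (8 * (a / 8) + 16)) := by
  have hj := Finset.mem_Icc.1 (Finset.mem_sdiff.1 hj).1
  refine Set.Ioo_subset_Ioo ?_ ?_ <;> refine mul_le_mul_of_nonneg_left ?_ (by positivity) <;> omega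

lemma exposureZone_subset (k : ℕ) (x : ℤ) :
    exposureZone k x ⊆ Set.Ioo (2 ^ k * (8 * (x / 2 ^ k / 8) - 8))
      (2 ^ k * (8 * (x / 2 ^ k / 8) + 16)) := by
  refine Set.Ioo_subset_Ioo ?_ ?_ <;> refine mul_le_mul_of_nonneg_left ?_ (by positivity) <;> omega

variable [Fintype ι] [DecidableEq ι]

lemma prob_exposedEvent_inter_blocking (hπ : IsUnfolding N π) (hN : 2 ^ k * 24 ≤ N)
    (hk : k + 3 ≤ K) :
    prob (exposedEvent π K k x ∩
        blockingCoins K k (x / 2 ^ k) ×ˢ blockingInputs π k (x / 2 ^ k)) =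
      prob (exposedEvent π K k x) *
        prob (blockingCoins K k (x / 2 ^ k) ×ˢ blockingInputs π k (x / 2 ^ k)) := by
  refine prob_inter_of_dependsOn (C := {i | (i : ℕ) < k})
    (D := {i | ∃ y ∈ exposureZone k x, π y = some i}) (fun s t hc hω => ?_) fun s t hc hω => ?_
  · refine mem_exposed_congr (fun i (hi : i < k) => ?_)
      (eqOn_pullInput fun y hy i hi => hω ⟨y, hy, hi⟩)
    rw [extendCoins_of_lt _ (by omega), extendCoins_of_lt _ (by omega)]
    exact hc hi
  · have coin_eq {i : ℕ} (hki : k ≤ i) (hi : i < K) : extendCoins s.1 i = extendCoins t.1 i := by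
      rw [extendCoins_of_lt _ hi, extendCoins_of_lt _ hi]
      exact hc (not_lt.2 hki)
    have node_eq (j) (hj : j ∈ blockingNodes (x / 2 ^ k)) :
        strideMaj (pullInput π s.2) k j = strideMaj (pullInput π t.2) k j := by
      refine strideMaj_congr_cone (eqOn_pullInput fun y hy i hi => hω ?_)
      rintro ⟨z, hz, hzi⟩
      have hyz : y = z := hπ.eq_of_mem_Ioo (by linarith) (cone_subset_of_mem_blockingNodes hj k hy)
        (exposureZone_subset k x hz) hi hzi
      exact Set.disjoint_left.1 (disjoint_cone_exposureZone (Finset.mem_sdiff.1 hj).2) hy (hyz ▸ hz)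
    refine and_congr ?_ ?_
    · rw [blockingCoins, Set.mem_ofPred_eq, Set.mem_ofPred_eq, coin_eq (by omega) (by omega),
        coin_eq (by omega) (by omega)]
    · simp only [blockingInputs, Set.mem_iInter₂, Set.mem_ofPred_eq]
      exact forall₂_congr fun j hj => by rw [node_eq j hj]

lemma prob_blockingCoins (hk : k + 3 ≤ K) (a : ℤ) : prob (blockingCoins K k a) = (1 / 4) ^ 2 := by
  let i₁ : Fin K := ⟨k + 1, by omega⟩
  let i₂ : Fin K := ⟨k + 2, by omega⟩
  have ne : i₁ ≠ i₂ := by simp [i₁, i₂]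
  have eq_setOf : blockingCoins K k a = {c | ∀ i ∈ ({i₁, i₂} : Finset (Fin K)),
      c i = if i = i₁ then ((2 * (a / 4) + 1 : ℤ) : ZMod 4) else (a / 2 - a / 4 : ℤ)} := by
    ext c
    simp only [blockingCoins, Set.mem_ofPred_eq, Finset.mem_insert, Finset.mem_singleton,
      forall_eq_or_imp, forall_eq, if_true, if_neg ne.symm]
    rw [extendCoins_of_lt, extendCoins_of_lt]
  rw [eq_setOf, prob_forall_mem_eq, Finset.card_pair ne, ZMod.card]
  norm_num

lemma one_half_le_prob_strideMaj_eq_one (π : ℤ → Option ι) (k : ℕ) (j : ℤ) :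
    1 / 2 ≤ prob {ω | strideMaj (pullInput π ω) k j = 1} := by
  refine one_half_le_prob (Equiv.neg _) fun ω => ?_
  refine (Int.units_eq_one_or (strideMaj (pullInput π ω) k j)).imp id fun h => ?_
  have neg_le : strideMaj (-pullInput π ω) k j ≤ strideMaj (pullInput π (-ω)) k j :=
    monotone_strideMaj k (neg_pullInput_le π ω) j
  rw [strideMaj_neg, Pi.neg_apply, h, neg_neg] at neg_le
  exact eq_one_of_one_le neg_le

lemma le_prob_blockingInputs (π : ℤ → Option ι) (k : ℕ) (a : ℤ) :
    (1 / 2) ^ 19 ≤ prob (blockingInputs π k a) := by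
  rw [← card_blockingNodes a]
  exact pow_card_le_prob_biInter (isUpperSet_strideMaj_eq_one π k) (by norm_num) _
    fun j _ => one_half_le_prob_strideMaj_eq_one π k j

lemma prob_exposedEvent_add_three_le (hπ : IsUnfolding N π) (hN : 2 ^ k * 24 ≤ N)
    (hk : k + 3 ≤ K) : prob (exposedEvent π K (k + 3) x) ≤
      (1 - (1 / 2) ^ 23) * prob (exposedEvent π K k x) := by
  set B := blockingCoins K k (x / 2 ^ k) ×ˢ blockingInputs π k (x / 2 ^ k) with hB
  have le_prob_blocking : (1 / 2) ^ 23 ≤ prob B := by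
    rw [hB, prob_prod, prob_blockingCoins hk]
    linarith [le_prob_blockingInputs π k (x / 2 ^ k)]
  calc prob (exposedEvent π K (k + 3) x)
      ≤ prob (exposedEvent π K k x \ B) := prob_mono (exposedEvent_add_three_subset K k x)
    _ = (1 - prob B) * prob (exposedEvent π K k x) := by
        rw [prob_diff, prob_exposedEvent_inter_blocking hπ hN hk]; ring
    _ ≤ (1 - (1 / 2) ^ 23) * prob (exposedEvent π K k x) :=
        mul_le_mul_of_nonneg_right (by linarith) (prob_nonneg _)

lemma prob_exposedEvent_three_mul_le (hπ : IsUnfolding (2 ^ (K + 2)) π) (x : ℤ) :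
    ∀ t : ℕ, 3 * t ≤ K → prob (exposedEvent π K (3 * t) x) ≤ (1 - (1 / 2) ^ 23) ^ t
  | 0, _ => by simpa using prob_le_one _
  | t + 1, ht => by
    have hN : (2 : ℤ) ^ (3 * t) * 24 ≤ 2 ^ (K + 2) :=
      calc (2 : ℤ) ^ (3 * t) * 24 ≤ 2 ^ (3 * t) * 2 ^ 5 := by gcongr; norm_num
        _ = 2 ^ (3 * t + 5) := (pow_add _ _ _).symm
        _ ≤ 2 ^ (K + 2) := pow_le_pow_right₀ (by norm_num) (by omega)
    calc prob (exposedEvent π K (3 * t + 3) x)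
        ≤ (1 - (1 / 2) ^ 23) * prob (exposedEvent π K (3 * t) x) :=
          prob_exposedEvent_add_three_le hπ hN ht
      _ ≤ (1 - (1 / 2) ^ 23) * (1 - (1 / 2) ^ 23) ^ t :=
          mul_le_mul_of_nonneg_left (prob_exposedEvent_three_mul_le hπ x t (by omega)) (by norm_num)
      _ = (1 - (1 / 2) ^ 23) ^ (t + 1) := (pow_succ' _ _).symm

theorem IsUnfolding.hasRevealmentLE (hπ : IsUnfolding (2 ^ (K + 2)) π) :
    HasRevealmentLE (fun ω => strideMaj (pullInput π ω) K) ((1 - (1 / 2) ^ 23) ^ (K / 3)) := by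
  let J (c : Fin K → ZMod 4) (ω : ι → ℤˣ) : Set ι :=
    {i | ∃ y, π y = some i ∧ y ∈ exposed (extendCoins c) K (pullInput π ω)}
  have eqOn_exposed {c : Fin K → ZMod 4} {ω η : ι → ℤˣ} (h : Set.EqOn ω η (J c ω)) :
      Set.EqOn (pullInput π ω) (pullInput π η) (exposed (extendCoins c) K (pullInput π ω)) :=
    eqOn_pullInput fun y hy i hi => h ⟨y, hi, hy⟩
  refine ⟨Fin K → ZMod 4, inferInstance, inferInstance, J, fun c ω η h => ?_, fun c ω η h => ?_,
    fun i => ?_⟩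
  · simp only [J, determines_exposed_exposed _ _ (eqOn_exposed h)]
  · exact determines_exposed_strideMaj _ _ (eqOn_exposed h)
  · by_cases hi : ∃ y, π y = some i
    · obtain ⟨y, hy⟩ := hi
      calc prob {s : (Fin K → ZMod 4) × (ι → ℤˣ) | i ∈ J s.1 s.2}
          ≤ prob (exposedEvent π K (3 * (K / 3)) y) := prob_mono fun s ⟨z, hz, hmem⟩ =>
            exposedEvent_antitone K y (Nat.mul_div_le K 3) ((hπ.mem_exposed_iff _ _ hy hz).2 hmem)
        _ ≤ (1 - (1 / 2) ^ 23) ^ (K / 3) :=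
            prob_exposedEvent_three_mul_le hπ y _ (Nat.mul_div_le K 3)
    · have empty : {s : (Fin K → ZMod 4) × (ι → ℤˣ) | i ∈ J s.1 s.2} = ∅ :=
        Set.eq_empty_of_forall_notMem fun s ⟨y, hy, _⟩ => hi ⟨y, hy⟩
      rw [empty]
      simp only [prob, Set.indicator_empty, Finset.expect_const_zero]
      norm_num

end Unfolding

lemma LayeredGraph.mem_children {G : LayeredGraph} {k : ℕ} {v : G.Node (k + 1)} {u : G.Node k} :
    u ∈ G.children k v ↔ G.edge k v u := by
  simp [children]

lemma LayeredGraph.value_factorsThrough (G : LayeredGraph) {k l : ℕ} (h : k ≤ l) :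
    Function.FactorsThrough (fun ω => G.value ω l) fun ω => G.value ω k := fun ω η hωη => by
  induction l, h using Nat.le_induction with
  | base => exact hωη
  | succ l _ ih => exact funext fun v => congrArg (majority (G.children l v)) ih

/-- The layout of the bits `1, …, N` at their own places on the integers. -/
def lineSite (N : ℕ) (y : ℤ) : Option (Finset.Icc 1 N) :=
  if h : 1 ≤ y ∧ y ≤ N then some ⟨y.toNat, by rw [Finset.mem_Icc]; omega⟩ else none

lemma lineSite_eq_some {N : ℕ} {y : ℤ} {i : Finset.Icc 1 N} :
    lineSite N y = some i ↔ y = ((i : ℕ) : ℤ) := by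
  have hi := Finset.mem_Icc.1 i.2
  unfold lineSite
  split_ifs with h
  · rw [Option.some_inj, Subtype.ext_iff]
    simp only
    omega
  · simp only [false_iff]
    omega

lemma isUnfolding_lineSite (N : ℕ) (d : ℤ) : IsUnfolding d (lineSite N) where
  dvd_sub hy hz := by rw [lineSite_eq_some.1 hy, lineSite_eq_some.1 hz, sub_self]; exact dvd_zero d
  periodic hy hz := by
    rw [lineSite_eq_some.1 hy, lineSite_eq_some.1 hz, sub_self]
    exact fun t => by rw [add_zero]

lemma bijOn_children_strideTwoGraph {n k : ℕ} (hk : k < n) (v : (strideTwoGraph n).Node (k + 1)) :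
    Set.BijOn (fun u : (strideTwoGraph n).Node k => ((u : ℕ) : ℤ)) ((strideTwoGraph n).children k v)
      (strideChildren (v : ℕ)) := by
  have hv : 1 ≤ (v : ℕ) ∧ (v : ℕ) ≤ 2 ^ (n - (k + 1) + 1) - 1 := Finset.mem_Icc.1 v.2
  have width_eq : (strideTwoGraph n).width k = 2 * 2 ^ (n - (k + 1) + 1) - 1 := by
    rw [← pow_succ', show n - (k + 1) + 1 + 1 = n - k + 1 by omega]
    rfl
  have mem_iff (u : (strideTwoGraph n).Node k) :
      u ∈ (strideTwoGraph n).children k v ↔ ((u : ℕ) : ℤ) ∈ strideChildren (v : ℕ) := by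
    rw [LayeredGraph.mem_children, Finset.mem_Icc]
    change |((u : ℕ) : ℤ) - 2 * ((v : ℕ) : ℤ)| ≤ 1 ↔ _
    rw [abs_le]
    omega
  refine ⟨fun u hu => (mem_iff u).1 hu,
    fun u _ u' _ (h : ((u : ℕ) : ℤ) = (u' : ℕ)) => Subtype.ext (Int.ofNat_inj.1 h), fun t ht => ?_⟩
  have ht_mem := Finset.mem_Icc.1 ht
  have toNat_eq : (t.toNat : ℤ) = t := by omega
  let u : (strideTwoGraph n).Node k := ⟨t.toNat, by rw [Finset.mem_Icc, width_eq]; omega⟩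
  exact ⟨u, (mem_iff u).2 (toNat_eq.symm ▸ ht), toNat_eq⟩

lemma value_strideTwoGraph {n k : ℕ} (hk : k ≤ n) (ω : (strideTwoGraph n).Node 0 → ℤˣ)
    (v : (strideTwoGraph n).Node k) :
    (strideTwoGraph n).value ω k v =
      strideMaj (pullInput (lineSite ((strideTwoGraph n).width 0)) ω) k (v : ℕ) := by
  induction k with
  | zero =>
    rw [strideMaj, pullInput, lineSite_eq_some.2 rfl]
    rfl
  | succ k ih =>
    exact majority_eq_of_bijOn _ (bijOn_children_strideTwoGraph hk v) fun u _ => ih (by omega) u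

theorem hasRevealmentLE_strideTwoGraph (n : ℕ) :
    HasRevealmentLE (strideTwoGraph n).output ((1 - (1 / 2) ^ 23) ^ (n / 3)) :=
  (isUnfolding_lineSite _ _).hasRevealmentLE.of_factorsThrough fun ω η h => by
    have output_eq (ω) := value_strideTwoGraph le_rfl ω (strideTwoGraph n).root
    exact (output_eq ω).trans ((congrFun h _).trans (output_eq η).symm)

/-- The node of the cycle `1, …, N` congruent to an integer. -/
def cycleSite {N : ℕ} (hN : 0 < N) (y : ℤ) : Finset.Icc 1 N :=
  ⟨((y - 1) % N).toNat + 1, by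
    have := Int.emod_nonneg (y - 1) (show (N : ℤ) ≠ 0 by omega)
    have := Int.emod_lt_of_pos (y - 1) (show 0 < (N : ℤ) by omega)
    rw [Finset.mem_Icc]; omega⟩

section CycleSite

variable {N : ℕ} {hN : 0 < N} {y z : ℤ}

variable (hN y) in
lemma cycleSite_modEq : ((cycleSite hN y : ℕ) : ℤ) ≡ y [ZMOD N] := by
  have emod_nonneg := Int.emod_nonneg (y - 1) (show (N : ℤ) ≠ 0 by omega)
  have site_eq : ((cycleSite hN y : ℕ) : ℤ) = (y - 1) % N + 1 := by simp only [cycleSite]; omega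
  rw [site_eq]
  simpa using (Int.mod_modEq (y - 1) N).add_right 1

lemma eq_cycleSite_iff {i : Finset.Icc 1 N} :
    i = cycleSite hN y ↔ ((i : ℕ) : ℤ) ≡ y [ZMOD N] := by
  refine ⟨fun h => h ▸ cycleSite_modEq hN y, fun h => Subtype.ext ?_⟩
  have hi := Finset.mem_Icc.1 i.2
  have hs := Finset.mem_Icc.1 (cycleSite hN y).2
  have dvd := (h.trans (cycleSite_modEq hN y).symm).dvd
  have abs_sub_lt : |((cycleSite hN y : ℕ) : ℤ) - (i : ℕ)| < N := by rw [abs_lt]; omega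
  have := Int.eq_zero_of_abs_lt_dvd dvd abs_sub_lt
  omega

lemma cycleSite_eq_cycleSite_iff : cycleSite hN y = cycleSite hN z ↔ y ≡ z [ZMOD N] := by
  rw [eq_cycleSite_iff]
  exact ⟨(cycleSite_modEq hN y).symm.trans, (cycleSite_modEq hN y).trans⟩

lemma isUnfolding_cycleSite (hN : 0 < N) {d : ℤ} (hd : d ∣ N) :
    IsUnfolding d fun y => some (cycleSite hN y) where
  dvd_sub hy hz := hd.trans
    (cycleSite_eq_cycleSite_iff.1 (Option.some_inj.1 (hy.trans hz.symm))).dvd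
  periodic hy hz t := by
    have dvd := (cycleSite_eq_cycleSite_iff.1 (Option.some_inj.1 (hy.trans hz.symm))).dvd
    refine congrArg some (cycleSite_eq_cycleSite_iff.2 (Int.ModEq.symm ?_))
    rwa [Int.modEq_iff_dvd, add_sub_cancel_left]

end CycleSite

section StrideTwoCycle

variable {m T k : ℕ}

lemma width_strideTwoCycle (hk : k ≤ T) : (strideTwoCycle m T).width k = m * 2 ^ (T - k) := by
  simp [strideTwoCycle, hk]

lemma width_strideTwoCycle_pos (hm : 0 < m) (hk : k ≤ T) : 0 < (strideTwoCycle m T).width k := by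
  rw [width_strideTwoCycle hk]
  positivity

lemma width_strideTwoCycle_eq_two_mul (hk : k < T) :
    (strideTwoCycle m T).width k = 2 * (strideTwoCycle m T).width (k + 1) := by
  rw [width_strideTwoCycle hk.le, width_strideTwoCycle hk, show T - k = T - (k + 1) + 1 by omega]
  ring

lemma mem_children_strideTwoCycle (hk : k < T) {v : (strideTwoCycle m T).Node (k + 1)}
    {u : (strideTwoCycle m T).Node k} : u ∈ (strideTwoCycle m T).children k v ↔
      ∃ e : ℤ, |e| ≤ 1 ∧ ((u : ℕ) : ℤ) ≡ 2 * (v : ℕ) + e [ZMOD (strideTwoCycle m T).width k] := by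
  rw [LayeredGraph.mem_children]
  generalize (u : ℕ) = j
  rw [width_strideTwoCycle hk.le]
  simp only [strideTwoCycle, if_pos hk]

lemma bijOn_children_strideTwoCycle (hm : 0 < m) (hk : k + 2 ≤ T) (j : ℤ) :
    Set.BijOn (cycleSite (width_strideTwoCycle_pos hm (show k ≤ T by omega))) (strideChildren j)
      ((strideTwoCycle m T).children k
        (cycleSite (width_strideTwoCycle_pos hm (show k + 1 ≤ T by omega)) j)) := by
  set v := cycleSite (width_strideTwoCycle_pos hm (show k + 1 ≤ T by omega)) j
  have width_eq := width_strideTwoCycle_eq_two_mul (m := m) (show k < T by omega)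
  have width_eq' := width_strideTwoCycle_eq_two_mul (m := m) (show k + 1 < T by omega)
  have width_pos : 0 < (strideTwoCycle m T).width (k + 1 + 1) := width_strideTwoCycle_pos hm hk
  have two_mul_modEq : 2 * ((v : ℕ) : ℤ) ≡ 2 * j [ZMOD (strideTwoCycle m T).width k] := by
    rw [width_eq, Nat.cast_mul]
    exact (cycleSite_modEq _ j).mul_left'
  refine ⟨fun t ht => ?_, fun t ht t' ht' h => ?_, fun u hu => ?_⟩
  · have ht := Finset.mem_Icc.1 ht
    refine (mem_children_strideTwoCycle (by omega)).2 ⟨t - 2 * j, by rw [abs_le]; omega, ?_⟩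
    have := two_mul_modEq.symm.add_right (t - 2 * j)
    rw [add_sub_cancel] at this
    exact (cycleSite_modEq _ t).trans this
  · have ht := Finset.mem_Icc.1 ht
    have ht' := Finset.mem_Icc.1 ht'
    have abs_sub_lt : |t' - t| < (strideTwoCycle m T).width k := by rw [abs_lt]; omega
    have := Int.eq_zero_of_abs_lt_dvd (cycleSite_eq_cycleSite_iff.1 h).dvd abs_sub_lt
    omega
  · obtain ⟨e, he, hue⟩ := (mem_children_strideTwoCycle (by omega)).1 hu
    rw [abs_le] at he
    exact ⟨2 * j + e, Finset.mem_Icc.2 (by omega),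
      (eq_cycleSite_iff.2 (hue.trans (two_mul_modEq.add_right e))).symm⟩

lemma value_strideTwoCycle (hm : 0 < m) (hk : k + 2 ≤ T) (ω : (strideTwoCycle m T).Node 0 → ℤˣ)
    (j : ℤ) : (strideTwoCycle m T).value ω k
        (cycleSite (width_strideTwoCycle_pos hm (show k ≤ T by omega)) j) =
      strideMaj (pullInput (fun y => some
        (cycleSite (width_strideTwoCycle_pos hm T.zero_le) y)) ω) k j := by
  induction k generalizing j with
  | zero => rfl
  | succ k ih =>
    exact (majority_eq_of_bijOn _ (bijOn_children_strideTwoCycle hm (by omega) j)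
      fun t _ => (ih (by omega) t).symm).symm

theorem hasRevealmentLE_strideTwoCycle (hm : 0 < m) (hT : 2 ≤ T) :
    HasRevealmentLE (fun ω => (strideTwoCycle m T).value ω T)
      ((1 - (1 / 2) ^ 23) ^ ((T - 2) / 3)) := by
  have dvd : (2 : ℤ) ^ (T - 2 + 2) ∣ (strideTwoCycle m T).width 0 := by
    rw [width_strideTwoCycle T.zero_le, Nat.sub_add_cancel hT]
    exact ⟨m, by push_cast; exact mul_comm _ _⟩
  have unfolding := isUnfolding_cycleSite (width_strideTwoCycle_pos hm T.zero_le) dvd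
  refine unfolding.hasRevealmentLE.of_factorsThrough fun ω η h =>
    (strideTwoCycle m T).value_factorsThrough (T.sub_le 2) (funext fun v => ?_)
  have hv : v = cycleSite (width_strideTwoCycle_pos hm (T.sub_le 2)) (v : ℕ) :=
    eq_cycleSite_iff.2 (Int.ModEq.refl _)
  have value_eq (ω) := (congrArg ((strideTwoCycle m T).value ω (T - 2)) hv).trans
    (value_strideTwoCycle hm (by omega) ω (v : ℕ))
  exact (value_eq ω).trans ((congrFun h _).trans (value_eq η).symm)

end StrideTwoCycle

lemma tendsto_pow_div_three {r : ℝ} (h0 : 0 ≤ r) (h1 : r < 1) {K : ℕ → ℕ}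
    (hK : Tendsto K atTop atTop) : Tendsto (fun n => r ^ (K n / 3)) atTop (𝓝 0) :=
  (tendsto_pow_atTop_nhds_zero_of_lt_one h0 h1).comp
    ((Nat.tendsto_div_const_atTop (by norm_num)).comp hK)

theorem mainTheorem9_general :
    NoiseSensitive (fun n => (strideTwoGraph n).output) ∧
    ∀ m T : ℕ → ℕ, (∀ n, 0 < m n) → Tendsto T atTop atTop →
      ∀ g : ∀ n, ((strideTwoCycle (m n) (T n)).Node (T n) → ℤˣ) → ℤˣ,
        NoiseSensitive fun n ω => g n ((strideTwoCycle (m n) (T n)).value ω (T n)) := by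
  refine ⟨noiseSensitive_of_hasRevealmentLE (fun n => pow_nonneg (by norm_num) _)
    (tendsto_pow_div_three (by norm_num) (by norm_num) tendsto_id)
    (.of_forall hasRevealmentLE_strideTwoGraph), fun m T hm hT g => ?_⟩
  refine noiseSensitive_of_hasRevealmentLE (δ := fun n => (1 - (1 / 2) ^ 23) ^ ((T n - 2) / 3))
    (fun n => pow_nonneg (by norm_num) _)
    (tendsto_pow_div_three (by norm_num) (by norm_num) ((tendsto_sub_atTop_nat 2).comp hT)) ?_
  filter_upwards [hT.eventually_ge_atTop 2] with n hn
  exact (hasRevealmentLE_strideTwoCycle (hm n) hn).of_factorsThrough fun ω η h => congrArg (g n) h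

theorem mainTheorem9 :
    NoiseSensitive (fun n => (strideTwoGraph n).output) ∧
    ∀ m T : ℕ → ℕ, (∀ n, 3 ≤ m n) → (∀ n, Odd (m n)) → Tendsto T atTop atTop →
      NoiseSensitive (fun n => (strideTwoCycle (m n) (T n)).output) :=
  ⟨mainTheorem9_general.1, fun m T hm _ hT =>
    mainTheorem9_general.2 m T (fun n => three_pos.trans_le (hm n)) hT fun n =>
      majority ((strideTwoCycle (m n) (T n)).children (T n) (strideTwoCycle (m n) (T n)).root)⟩
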